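/- Let $D$ be an oriented knot diagram in the oriented sphere $S^2$, that is, a smooth immersion of the oriented circle in $S^2$ whose only multiple points are finitely many transverse double points, with over-under information at each of them (diagrams being considered up to orientation-preserving diffeomorphism of $S^2$ and orientation-preserving reparametrization). Let $n(D)$ be its number of crossings and $w(D)$ its writhe, the sum of the signs of its crossings. Two crossings $c,d$ are interleaved if they are met in the cyclic order $c,d,c,d$ when one travels once along the knot; the cowrithe $x(D)$ is the sum, over all unordered pairs of interleaved crossings, of the product of their two signs. An RI move creates or deletes a monogon face, an RII move a bigon face. An RII move is matched (resp. unmatched) if the two strands bounding the bigon run in the same direction (resp. in opposite directions) along it. An RIII move deletes a triangle face and creates a new one by moving a strand across the crossing of two other strands. It is called negative if the created triangle face $\Delta$ has sign $-1$, where the sign of $\Delta$ is $(-1)^q$ for the following $q$: choose a base point on the knot outside $\Delta$, let $e_1,e_2,e_3$ be the edges of $\Delta$ in the order in which they are met along the knot from the base point, orient $\partial\Delta$ so that $e_1,e_2,e_3$ are met in this order, and let $q$ be the number of edges on which the orientations of $\partial\Delta$ and of the knot agree. Then: (1) $x+\frac n2-\frac w2$ does not change under an RI move creating a positive crossing or under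 a matched RII move, and it increases by $1$ under an RI move creating a negative crossing, under an unmatched RII move creating a bigon face, and under a negative RIII move. (2) $x+\frac n2+\frac w2$ does not change under an RI move creating a negative crossing or under a matched RII move, and it increases by $1$ under an RI move creating a positive crossing, under an unmatched RII move creating a bigon face, and under a negative RIII move. -/

import Mathlib

open Set
open scoped ContDiff

/-- The unit sphere `S²` in `ℝ³`. -/
def unitSphere : Set (Fin 3 → ℝ) := {x | dotProduct x x = 1}

/-- The determinant of three vectors of `ℝ³`, as a triple product.  For `p ∈ S²` and `a`, `b` tangent
to `S²` at `p`, it is positive exactly when `(a, b)` is a positive frame of `S²` with its outward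
orientation. -/
noncomputable def tripleProduct (a b c : Fin 3 → ℝ) : ℝ := dotProduct a (crossProduct b c)

/-- An oriented knot diagram in `S²`: a generic smooth immersion of the oriented circle `ℝ / ℤ`
(written as a `1`-periodic curve), with over-under information at each double point. -/
structure KnotDiagram where
  /-- the underlying spherical curve -/
  curve : ℝ → (Fin 3 → ℝ)
  smooth : ContDiff ℝ ∞ curve
  periodic : ∀ t, curve (t + 1) = curve t
  mem_sphere : ∀ t, curve t ∈ unitSphere
  immersed : ∀ t, deriv curve t ≠ 0
  finite_double : {c : ℝ × ℝ | 0 ≤ c.1 ∧ c.1 < c.2 ∧ c.2 < 1 ∧ curve c.1 = curve c.2}.Finite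
  no_triple : ∀ r s t, r < s → s < t → t < r + 1 → ¬ (curve r = curve s ∧ curve s = curve t)
  transverse : ∀ s t, s < t → t < s + 1 → curve s = curve t →
    LinearIndependent ℝ ![deriv curve s, deriv curve t]
  /-- the parameters at which the curve passes over at a double point -/
  overSet : Set ℝ
  over_periodic : ∀ t, t + 1 ∈ overSet ↔ t ∈ overSet
  double_of_over : ∀ t ∈ overSet, ∃ s, t < s ∧ s < t + 1 ∧ curve s = curve t
  over_iff : ∀ s t, s < t → t < s + 1 → curve s = curve t → (s ∈ overSet ↔ t ∉ overSet)

namespace KnotDiagram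

/-- The crossings, each given by its two parameters in `[0, 1)` in increasing order. -/
def crossings (D : KnotDiagram) : Set (ℝ × ℝ) :=
  {c | 0 ≤ c.1 ∧ c.1 < c.2 ∧ c.2 < 1 ∧ D.curve c.1 = D.curve c.2}

/-- The finite set of crossings. -/
noncomputable def crossingFinset (D : KnotDiagram) : Finset (ℝ × ℝ) := D.finite_double.toFinset

/-- The number of crossings. -/
noncomputable def numCrossings (D : KnotDiagram) : ℕ := D.crossings.ncard

open Classical in
/-- The sign of the crossing with parameters `s`, `t`: it is `1` if the direction of the over-strand
followed by the direction of the under-strand is a positive frame of `S²`, and `-1` otherwise. -/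
noncomputable def crossingSign (D : KnotDiagram) (s t : ℝ) : ℤ :=
  if s ∈ D.overSet then
    (SignType.sign (tripleProduct (D.curve s) (deriv D.curve s) (deriv D.curve t)) : ℤ)
  else
    (SignType.sign (tripleProduct (D.curve s) (deriv D.curve t) (deriv D.curve s)) : ℤ)

/-- The writhe: the sum of the signs of all crossings. -/
noncomputable def writhe (D : KnotDiagram) : ℤ :=
  ∑ c ∈ D.crossingFinset, D.crossingSign c.1 c.2

open Classical in
/-- The cowrithe: the sum, over all unordered pairs of interleaved crossings (that is, those met in
the order `c, d, c, d` along the knot), of the product of their two signs.  Listing first the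
crossing that is met first, every such pair occurs exactly once. -/
noncomputable def cowrithe (D : KnotDiagram) : ℤ :=
  ∑ e ∈ (D.crossingFinset ×ˢ D.crossingFinset).filter
      (fun e => e.1.1 < e.2.1 ∧ e.2.1 < e.1.2 ∧ e.1.2 < e.2.2),
    D.crossingSign e.1.1 e.1.2 * D.crossingSign e.2.1 e.2.2

/-- Two diagrams are equivalent if they correspond to each other under an orientation-preserving
diffeomorphism of `S²` and an orientation-preserving change of parameter of the circle. -/
def Equivalent (D E : KnotDiagram) : Prop :=
  ∃ (h : ℝ → ℝ) (Φ : (Fin 3 → ℝ) → (Fin 3 → ℝ)),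
    ContDiff ℝ ∞ h ∧ (∀ t, 0 < deriv h t) ∧ (∀ t, h (t + 1) = h t + 1) ∧
    ContDiff ℝ ∞ Φ ∧ BijOn Φ unitSphere unitSphere ∧
    (∀ p ∈ unitSphere, ∀ a b : Fin 3 → ℝ, dotProduct p a = 0 → dotProduct p b = 0 →
      0 < tripleProduct p a b → 0 < tripleProduct (Φ p) (fderiv ℝ Φ p a) (fderiv ℝ Φ p b)) ∧
    (∀ t, E.curve (h t) = Φ (D.curve t)) ∧ (∀ t, h t ∈ E.overSet ↔ t ∈ D.overSet)

end KnotDiagram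

/-- A replacement of `k` strands inside a disc.  The disc is the image of the square `[-1, 1]²` under
a positively oriented smooth embedding `chart` of the plane in `S²`.  The parts of the two diagrams in
this disc are the `k` strands with parameter intervals `[start i, finish i]`, numbered in the order in
which they are met along the knot from the base point `0`, which is outside the disc.  Outside the
disc the two diagrams coincide. -/
structure LocalChange (k : ℕ) (D D' : KnotDiagram) where
  chart : ℝ × ℝ → (Fin 3 → ℝ)
  chart_smooth : ContDiff ℝ ∞ chart
  chart_injective : Function.Injective chart
  chart_mem : ∀ x, chart x ∈ unitSphere
  chart_pos : ∀ x,
    0 < tripleProduct (chart x) (fderiv ℝ chart x (1, 0)) (fderiv ℝ chart x (0, 1))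
  start : Fin k → ℝ
  finish : Fin k → ℝ
  start_pos : ∀ i, 0 < start i
  start_lt_finish : ∀ i, start i < finish i
  finish_lt_one : ∀ i, finish i < 1
  ordered : ∀ i j, i < j → finish i < start j
  /-- the strands of `D`, in the coordinates of the chart -/
  old : ℝ → ℝ × ℝ
  /-- the strands of `D'`, in the coordinates of the chart -/
  new : ℝ → ℝ × ℝ
  old_smooth : ContDiff ℝ ∞ old
  new_smooth : ContDiff ℝ ∞ new
  old_eq : ∀ i, ∀ t ∈ Icc (start i) (finish i), D.curve t = chart (old t)
  new_eq : ∀ i, ∀ t ∈ Icc (start i) (finish i), D'.curve t = chart (new t)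
  old_mem : ∀ i, ∀ t ∈ Ioo (start i) (finish i), old t ∈ Ioo (-1 : ℝ) 1 ×ˢ Ioo (-1 : ℝ) 1
  new_mem : ∀ i, ∀ t ∈ Ioo (start i) (finish i), new t ∈ Ioo (-1 : ℝ) 1 ×ˢ Ioo (-1 : ℝ) 1
  outside : ∀ t ∈ Ico (0 : ℝ) 1, (∀ i, t ∉ Icc (start i) (finish i)) →
    D.curve t ∉ chart '' (Icc (-1 : ℝ) 1 ×ˢ Icc (-1 : ℝ) 1)
  curve_agree : ∀ t ∈ Ico (0 : ℝ) 1, (∀ i, t ∉ Ioo (start i) (finish i)) → D'.curve t = D.curve t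
  over_agree : ∀ t ∈ Ico (0 : ℝ) 1, (∀ i, t ∉ Ioo (start i) (finish i)) →
    (t ∈ D'.overSet ↔ t ∈ D.overSet)

namespace LocalChange

variable {k : ℕ} {D D' : KnotDiagram}

/-- The parameter interval of the `i`-th strand. -/
def arc (L : LocalChange k D D') (i : Fin k) : Set ℝ := Icc (L.start i) (L.finish i)

/-- The strands lie at distinct heights, the same before and after the replacement: wherever two
strands cross, in `D` or in `D'`, the higher one passes over the other. -/
def Layered (L : LocalChange k D D') : Prop :=
  ∃ level : Fin k → ℕ, Function.Injective level ∧
    ∀ i j, i ≠ j → ∀ s ∈ L.arc i, ∀ t ∈ L.arc j,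
      (D.curve s = D.curve t → (s ∈ D.overSet ↔ level j < level i)) ∧
      (D'.curve s = D'.curve t → (s ∈ D'.overSet ↔ level j < level i))

/-- An RI move creating a monogon whose crossing has sign `ε`: an embedded strand in a disc is
replaced by a strand with exactly one double point. -/
def IsRI (L : LocalChange 1 D D') (ε : ℤ) : Prop :=
  InjOn D.curve (L.arc 0) ∧
  ∃ p ∈ Ioo (L.start 0) (L.finish 0), ∃ q ∈ Ioo (L.start 0) (L.finish 0), p < q ∧
    (∀ s ∈ L.arc 0, ∀ t ∈ L.arc 0, s < t → (D'.curve s = D'.curve t ↔ s = p ∧ t = q)) ∧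
    D'.crossingSign p q = ε

/-- An RII move creating a bigon.  The strand `i` is the horizontal axis of the square and does not
move.  The embedded strand `j`, which lies above the axis, is replaced by an embedded strand that
meets the axis exactly twice, so that a bigon is formed with vertices at the parameters `p < q` of the
strand `j`, which are the parameters `p'`, `q'` of the strand `i`.  One strand passes over the other
at both crossings.  The move is matched if the two strands run through the bigon in the same
direction, and unmatched if they do so in opposite directions. -/
def IsRII (L : LocalChange 2 D D') (matched : Prop) : Prop :=
  L.Layered ∧ ∃ i j : Fin 2, i ≠ j ∧
    L.old '' L.arc i = Icc (-1 : ℝ) 1 ×ˢ {0} ∧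
    (∀ t ∈ L.arc i, L.new t = L.old t) ∧
    InjOn D.curve (L.arc i) ∧ InjOn D.curve (L.arc j) ∧ InjOn D'.curve (L.arc j) ∧
    (∀ t ∈ L.arc j, 0 < (L.old t).2) ∧
    ∃ p ∈ Ioo (L.start j) (L.finish j), ∃ q ∈ Ioo (L.start j) (L.finish j),
    ∃ p' ∈ Ioo (L.start i) (L.finish i), ∃ q' ∈ Ioo (L.start i) (L.finish i),
      p < q ∧ p' ≠ q' ∧
      (∀ s ∈ L.arc i, ∀ t ∈ L.arc j,
        D'.curve s = D'.curve t ↔ (s = p' ∧ t = p) ∨ (s = q' ∧ t = q)) ∧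
      (matched ↔ p' < q')

/-- In `E`, the three strands over the arcs of `L` are embedded and every two of them cross exactly
once; `cr i j` is the parameter on the strand `i` of its crossing with the strand `j`.  (Three such
strands in a disc bound a triangle face.) -/
def IsTriangle (L : LocalChange 3 D D') (E : KnotDiagram) (cr : Fin 3 → Fin 3 → ℝ) : Prop :=
  (∀ i j, i ≠ j → cr i j ∈ Ioo (L.start i) (L.finish i)) ∧
  ∀ i j, ∀ s ∈ L.arc i, ∀ t ∈ L.arc j,
    E.curve s = E.curve t ↔ (i = j ∧ s = t) ∨ (i ≠ j ∧ s = cr i j ∧ t = cr j i)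

end LocalChange

/-- The sign of a triangle face with edges `0, 1, 2`, numbered in the order in which they are met
along the knot, where `cr i j` is the parameter on the edge `i` of its common vertex with the edge
`j`.  The boundary of the triangle is oriented so that the edges are met in the order `0, 1, 2`, so it
passes the edge `i` from the vertex on the edge `i - 1` to the vertex on the edge `i + 1` (indices
modulo `3`).  The sign is `(-1) ^ q`, where `q` is the number of edges on which this orientation agrees
with that of the knot. -/
noncomputable def triangleSign (cr : Fin 3 → Fin 3 → ℝ) : ℤ :=
  (-1) ^ {i : Fin 3 | cr i (i - 1) < cr i (i + 1)}.ncard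

namespace LocalChange

variable {D D' : KnotDiagram}

/-- An RIII move of sign `ε`.  The strands `i` and `j` are the horizontal and the vertical axis of the
square and do not move.  The strand `k` runs from the second quadrant to the fourth one, and it is
moved across the origin, so that the order of the two crossings on each of the three strands is
reversed.  The sign of the move is the sign of the triangle face created in `D'`. -/
def IsRIII (L : LocalChange 3 D D') (ε : ℤ) : Prop :=
  L.Layered ∧ ∃ i j k : Fin 3, i ≠ j ∧ j ≠ k ∧ k ≠ i ∧
    L.old '' L.arc i = Icc (-1 : ℝ) 1 ×ˢ {0} ∧ (∀ t ∈ L.arc i, L.new t = L.old t) ∧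
    L.old '' L.arc j = {0} ×ˢ Icc (-1 : ℝ) 1 ∧ (∀ t ∈ L.arc j, L.new t = L.old t) ∧
    (L.old (L.start k)).1 < 0 ∧ 0 < (L.old (L.start k)).2 ∧
    0 < (L.old (L.finish k)).1 ∧ (L.old (L.finish k)).2 < 0 ∧
    ∃ cr cr' : Fin 3 → Fin 3 → ℝ, L.IsTriangle D cr ∧ L.IsTriangle D' cr' ∧
      (∀ a b c : Fin 3, a ≠ b → b ≠ c → c ≠ a → (cr a b < cr a c ↔ cr' a c < cr' a b)) ∧
      triangleSign cr' = ε

end LocalChange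

namespace KnotDiagram

/-- `D'` is obtained from `D`, up to equivalence of diagrams, by an RI move creating a crossing of
sign `ε`. -/
def RICreating (ε : ℤ) (D D' : KnotDiagram) : Prop :=
  ∃ E E' : KnotDiagram, Equivalent D E ∧ Equivalent E' D' ∧ ∃ L : LocalChange 1 E E', L.IsRI ε

/-- `D'` is obtained from `D`, up to equivalence of diagrams, by a matched RII move creating a bigon. -/
def MatchedRIICreating (D D' : KnotDiagram) : Prop :=
  ∃ E E' : KnotDiagram, Equivalent D E ∧ Equivalent E' D' ∧ ∃ L : LocalChange 2 E E', L.IsRII True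

/-- `D'` is obtained from `D`, up to equivalence of diagrams, by an unmatched RII move creating a
bigon. -/
def UnmatchedRIICreating (D D' : KnotDiagram) : Prop :=
  ∃ E E' : KnotDiagram, Equivalent D E ∧ Equivalent E' D' ∧ ∃ L : LocalChange 2 E E', L.IsRII False

/-- `D'` is obtained from `D`, up to equivalence of diagrams, by a matched RII move, which creates or
deletes a bigon. -/
def MatchedRII (D D' : KnotDiagram) : Prop :=
  MatchedRIICreating D D' ∨ MatchedRIICreating D' D

/-- `D'` is obtained from `D`, up to equivalence of diagrams, by a negative RIII move. -/
def NegativeRIII (D D' : KnotDiagram) : Prop :=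
  ∃ E E' : KnotDiagram, Equivalent D E ∧ Equivalent E' D' ∧ ∃ L : LocalChange 3 E E', L.IsRIII (-1)

/-- The quantity `x + n / 2 - w / 2`. -/
noncomputable def minusInvariant (D : KnotDiagram) : ℚ :=
  (D.cowrithe : ℚ) + (D.numCrossings : ℚ) / 2 - (D.writhe : ℚ) / 2

/-- The quantity `x + n / 2 + w / 2`. -/
noncomputable def plusInvariant (D : KnotDiagram) : ℚ :=
  (D.cowrithe : ℚ) + (D.numCrossings : ℚ) / 2 + (D.writhe : ℚ) / 2

end KnotDiagram

/-! The three numbers `n`, `w` and `x` are followed separately. An equivalence of diagrams induces a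
bijection of crossings that keeps signs and interleaving (`Equivalent.exists_crossing_bijection`),
so only moves inside a standard disc matter. There the crossings outside the disc keep their signs
and their mutual interleaving. Their interleaving with a crossing inside the disc depends only on
the two arcs that carry it, because no outside parameter separates two points of one arc
(`interleaved_iff_of_mem`).

RI: the new crossing is interleaved with nothing, so `x` is unchanged, `n` grows by `1` and `w` by
its sign. RII: the two new crossings have opposite signs and link the same outside crossings, so
those contributions cancel. What remains is their mutual product `-1`, present exactly when they are
interleaved, that is, when the move is matched. It offsets the growth of `n / 2` by `1`.

RIII: the signs of the three crossings persist, but two of them share a strand and their order on it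
is reversed, so each of the three pairs toggles between interleaved and not interleaved. The change
of `x` is therefore a signed sum over the three edges of the triangle. The term of each edge is
minus the sign of the created triangle, times a product of two height comparisons. These products
are `1` for the top and the bottom strand and `-1` for the middle one, so they add up to `1`
(`heightSign_sum`), and `x` changes by minus the sign (`sum_edges_eq_neg_triangleSign`,
`IsRIII.change`). -/

/-! ### Interleaved pairs -/

/-- The pairs `c`, `d` are met in the order `c, d, c, d` or `d, c, d, c`. -/
def Interleaved (c d : ℝ × ℝ) : Prop :=
  (c.1 < d.1 ∧ d.1 < c.2 ∧ c.2 < d.2) ∨ (d.1 < c.1 ∧ c.1 < d.2 ∧ d.2 < c.2)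

theorem interleaved_comm (c d : ℝ × ℝ) : Interleaved c d ↔ Interleaved d c := or_comm

theorem not_interleaved_self (c : ℝ × ℝ) : ¬ Interleaved c c := by
  rintro (h | h) <;> exact lt_irrefl _ h.1

open Classical in
/-- The sum of `g c * g d` over all unordered interleaved pairs in `C`. -/
noncomputable def interleavedSum (C : Finset (ℝ × ℝ)) (g : ℝ × ℝ → ℤ) : ℤ :=
  ∑ c ∈ C, ∑ d ∈ C, if c.1 < d.1 ∧ d.1 < c.2 ∧ c.2 < d.2 then g c * g d else 0

open Classical in
/-- The sum of `g c` over all `c` in `C` that are interleaved with `b`. -/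
noncomputable def linkSum (C : Finset (ℝ × ℝ)) (g : ℝ × ℝ → ℤ) (b : ℝ × ℝ) : ℤ :=
  ∑ c ∈ C, if Interleaved c b then g c else 0

theorem KnotDiagram.cowrithe_eq_interleavedSum (D : KnotDiagram) :
    D.cowrithe = interleavedSum D.crossingFinset (fun c => D.crossingSign c.1 c.2) := by
  classical
  unfold KnotDiagram.cowrithe interleavedSum
  rw [Finset.sum_filter, Finset.sum_product]

theorem KnotDiagram.numCrossings_eq_card (D : KnotDiagram) :
    D.numCrossings = D.crossingFinset.card :=
  Set.ncard_eq_toFinset_card _ D.finite_double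

theorem KnotDiagram.mem_crossingFinset (D : KnotDiagram) (c : ℝ × ℝ) :
    c ∈ D.crossingFinset ↔ 0 ≤ c.1 ∧ c.1 < c.2 ∧ c.2 < 1 ∧ D.curve c.1 = D.curve c.2 := by
  simp [KnotDiagram.crossingFinset]

open Classical in
theorem linkSum_insert {C : Finset (ℝ × ℝ)} {b : ℝ × ℝ} (hb : b ∉ C) (g : ℝ × ℝ → ℤ)
    (a : ℝ × ℝ) :
    linkSum (insert b C) g a = (if Interleaved b a then g b else 0) + linkSum C g a := by
  unfold linkSum
  rw [Finset.sum_insert hb]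

/-- The new pairs are those containing `b`. The crossing `b` is met first or second in them, and
these two exclusive cases are the two halves of `Interleaved`. -/
theorem interleavedSum_insert {C : Finset (ℝ × ℝ)} {b : ℝ × ℝ} (hb : b ∉ C)
    (g : ℝ × ℝ → ℤ) :
    interleavedSum (insert b C) g = interleavedSum C g + g b * linkSum C g b := by
  classical
  unfold interleavedSum linkSum
  rw [Finset.sum_insert hb, Finset.sum_insert hb]
  simp only [Finset.sum_insert hb]
  rw [Finset.sum_add_distrib, Finset.mul_sum]
  have key : ∀ c ∈ C, g b * (if Interleaved c b then g c else 0)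
      = (if b.1 < c.1 ∧ c.1 < b.2 ∧ b.2 < c.2 then g b * g c else 0)
        + (if c.1 < b.1 ∧ b.1 < c.2 ∧ c.2 < b.2 then g c * g b else 0) := by
    intro c _
    unfold Interleaved
    by_cases h1 : c.1 < b.1 ∧ b.1 < c.2 ∧ c.2 < b.2
    · have h2 : ¬ (b.1 < c.1 ∧ c.1 < b.2 ∧ b.2 < c.2) := fun h => lt_asymm h.1 h1.1
      simp [h1, h2, mul_comm]
    · simp [h1]
  rw [Finset.sum_congr rfl key, Finset.sum_add_distrib]
  simp
  ring

/-- This form is symmetric in the two crossings of a pair. It is needed because moving the base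
point can change which crossing of a pair is met first. -/
theorem two_mul_interleavedSum (C : Finset (ℝ × ℝ)) (g : ℝ × ℝ → ℤ) :
    2 * interleavedSum C g = ∑ c ∈ C, g c * linkSum C g c := by
  classical
  induction C using Finset.induction_on with
  | empty => simp [interleavedSum, linkSum]
  | insert b C hb ih =>
    rw [interleavedSum_insert hb, Finset.sum_insert hb, mul_add, ih]
    simp only [linkSum_insert hb, not_interleaved_self, if_false, mul_add,
      Finset.sum_add_distrib]
    have : ∑ x ∈ C, g x * (if Interleaved b x then g b else 0) = g b * linkSum C g b := by
      unfold linkSum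
      rw [Finset.mul_sum]
      refine Finset.sum_congr rfl fun x _ => ?_
      rw [interleaved_comm b x]
      split_ifs <;> ring
    rw [this]; ring

theorem interleavedSum_congr {C : Finset (ℝ × ℝ)} {g g' : ℝ × ℝ → ℤ}
    (h : ∀ c ∈ C, g c = g' c) : interleavedSum C g = interleavedSum C g' := by
  unfold interleavedSum
  exact Finset.sum_congr rfl fun c hc => Finset.sum_congr rfl fun d hd => by rw [h c hc, h d hd]

theorem linkSum_congr {C : Finset (ℝ × ℝ)} {g g' : ℝ × ℝ → ℤ} {b b' : ℝ × ℝ}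
    (h : ∀ c ∈ C, g c = g' c) (hb : ∀ c ∈ C, Interleaved c b ↔ Interleaved c b') :
    linkSum C g b = linkSum C g' b' := by
  unfold linkSum
  exact Finset.sum_congr rfl fun c hc => by
    have := hb c hc
    rw [h c hc]; by_cases hi : Interleaved c b' <;> simp_all

/-- Two pairs without common entries are interleaved when exactly one entry of the second lies between
the entries of the first. -/
theorem interleaved_iff_of_ne {c d : ℝ × ℝ} (hc : c.1 < c.2) (hd : d.1 < d.2)
    (h11 : c.1 ≠ d.1) (h12 : c.1 ≠ d.2) (h21 : c.2 ≠ d.1) (h22 : c.2 ≠ d.2) :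
    Interleaved c d ↔ ¬ ((c.1 < d.1 ↔ c.2 < d.1) ↔ (c.1 < d.2 ↔ c.2 < d.2)) := by
  unfold Interleaved
  rcases lt_or_gt_of_ne h11 with a | a <;> rcases lt_or_gt_of_ne h12 with b | b <;>
    rcases lt_or_gt_of_ne h21 with e | e <;> rcases lt_or_gt_of_ne h22 with f | f <;>
    simp only [a, b, e, f, not_lt_of_gt a, not_lt_of_gt b, not_lt_of_gt e, not_lt_of_gt f] <;>
    first | done | (simp; done) | (exfalso; linarith)

/-! ### Signs of crossings -/

theorem dotProduct_fin_three (a b : Fin 3 → ℝ) :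
    dotProduct a b = a 0 * b 0 + a 1 * b 1 + a 2 * b 2 := by
  simp [dotProduct, Fin.sum_univ_three]

theorem tripleProduct_swap (p a b : Fin 3 → ℝ) : tripleProduct p b a = -tripleProduct p a b := by
  simp only [tripleProduct, crossProduct, dotProduct_fin_three]
  simp
  ring

theorem tripleProduct_smul_smul (p a b : Fin 3 → ℝ) (x y : ℝ) :
    tripleProduct p (x • a) (y • b) = x * y * tripleProduct p a b := by
  simp only [tripleProduct, crossProduct, dotProduct_fin_three]
  simp
  ring

theorem tripleProduct_combination (p a b : Fin 3 → ℝ) (x y z w : ℝ) :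
    tripleProduct p (x • a + y • b) (z • a + w • b) = (x * w - y * z) * tripleProduct p a b := by
  simp only [tripleProduct, crossProduct, dotProduct_fin_three]
  simp
  ring

/-- For `a`, `b` orthogonal to the unit vector `p`, the cross product is the multiple of `p` whose
coefficient is the triple product. If the coefficient vanished, `a` and `b` would be dependent. -/
theorem tripleProduct_ne_zero {p a b : Fin 3 → ℝ} (hp : dotProduct p p = 1)
    (ha : dotProduct p a = 0) (hb : dotProduct p b = 0) (h : LinearIndependent ℝ ![a, b]) :
    tripleProduct p a b ≠ 0 := by
  intro h0
  apply crossProduct_ne_zero_iff_linearIndependent.mpr h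
  have key : crossProduct a b = tripleProduct p a b • p := by
    simp only [tripleProduct, crossProduct, dotProduct_fin_three] at *
    ext i
    fin_cases i
    · simp at *
      linear_combination (-(a 1 * b 2 - a 2 * b 1)) * hp + (b 2 * p 1 - b 1 * p 2) * ha +
        (a 1 * p 2 - a 2 * p 1) * hb
    · simp at *
      linear_combination (-(a 2 * b 0 - a 0 * b 2)) * hp + (b 0 * p 2 - b 2 * p 0) * ha +
        (a 2 * p 0 - a 0 * p 2) * hb
    · simp at *
      linear_combination (-(a 0 * b 1 - a 1 * b 0)) * hp + (b 1 * p 0 - b 0 * p 1) * ha +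
        (a 0 * p 1 - a 1 * p 0) * hb
  rw [key, h0, zero_smul]

/-! ### Tangent vectors, integer shifts of parameters, and the parameters of crossings -/

namespace KnotDiagram

variable (D : KnotDiagram)

theorem differentiable : Differentiable ℝ D.curve := D.smooth.differentiable (by simp)

theorem dotProduct_deriv (t : ℝ) : dotProduct (D.curve t) (deriv D.curve t) = 0 := by
  have hd := (D.differentiable t).hasDerivAt
  rw [hasDerivAt_pi] at hd
  have h1 := (((hd 0).mul (hd 0)).add ((hd 1).mul (hd 1))).add ((hd 2).mul (hd 2))
  have h2 := h1.congr_of_eventuallyEq (f₁ := fun _ => (1 : ℝ)) (.of_forall fun s =>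
    ((dotProduct_fin_three _ _).symm.trans (D.mem_sphere s)).symm)
  have h3 := h2.unique (hasDerivAt_const _ _)
  rw [dotProduct_fin_three]
  linarith

theorem deriv_periodic (t : ℝ) : deriv D.curve (t + 1) = deriv D.curve t := by
  rw [← deriv_comp_add_const]
  congr 1
  exact funext D.periodic

theorem tripleProduct_deriv_ne_zero {s t : ℝ} (h1 : s < t) (h2 : t < s + 1)
    (h : D.curve s = D.curve t) :
    tripleProduct (D.curve s) (deriv D.curve s) (deriv D.curve t) ≠ 0 :=
  tripleProduct_ne_zero (D.mem_sphere s) (D.dotProduct_deriv s)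
    (h ▸ D.dotProduct_deriv t) (D.transverse s t h1 h2 h)

theorem over_add_int (t : ℝ) (n : ℤ) : t + n ∈ D.overSet ↔ t ∈ D.overSet := by
  induction n using Int.induction_on with
  | zero => simp
  | succ n ih => rw [← ih, ← D.over_periodic (t + (n : ℤ))]; push_cast; rw [add_assoc]
  | pred n ih =>
    rw [← ih, ← D.over_periodic (t + _)]; push_cast
    rw [show t + (-(n : ℝ) - 1) + 1 = t + -(n : ℝ) by ring]

theorem curve_periodic : Function.Periodic D.curve 1 := D.periodic

theorem curve_add_int (t : ℝ) (n : ℤ) : D.curve (t + n) = D.curve t := by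
  simpa using D.curve_periodic.int_mul n t

theorem deriv_add_int (t : ℝ) (n : ℤ) : deriv D.curve (t + n) = deriv D.curve t := by
  simpa using (show Function.Periodic (deriv D.curve) 1 from D.deriv_periodic).int_mul n t

theorem crossingSign_add_int (s t : ℝ) (m n : ℤ) :
    D.crossingSign (s + m) (t + n) = D.crossingSign s t := by
  unfold crossingSign
  simp only [D.over_add_int, D.curve_add_int, D.deriv_add_int]
  by_cases h : s ∈ D.overSet <;> simp [h, D.over_add_int]

/-- The sign refers to the over-strand and the under-strand, and exactly one of the two parameters
is over. -/
theorem crossingSign_comm_of_lt {s t : ℝ} (h1 : s < t) (h2 : t < s + 1)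
    (h : D.curve s = D.curve t) : D.crossingSign t s = D.crossingSign s t := by
  unfold crossingSign
  have := D.over_iff s t h1 h2 h
  rw [h]
  by_cases hs : s ∈ D.overSet
  · simp [hs, this.mp hs]
  · have ht : t ∈ D.overSet := by tauto
    simp [hs, ht]

theorem crossingSign_comm {s t : ℝ} (hs : s ∈ Ico (0 : ℝ) 1) (ht : t ∈ Ico (0 : ℝ) 1)
    (h : D.curve s = D.curve t) : D.crossingSign t s = D.crossingSign s t := by
  rcases lt_trichotomy s t with h1 | h1 | h1
  · exact D.crossingSign_comm_of_lt h1 (by linarith [hs.1, ht.2]) h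
  · rw [h1]
  · exact (D.crossingSign_comm_of_lt h1 (by linarith [ht.1, hs.2]) h.symm).symm

/-- A parameter in `[0, 1)` belongs to at most one crossing. -/
theorem eq_of_curve_eq {r s t : ℝ} (hr : r ∈ Ico (0 : ℝ) 1) (hs : s ∈ Ico (0 : ℝ) 1)
    (ht : t ∈ Ico (0 : ℝ) 1) (hrs : r ≠ s) (hst : s ≠ t) (hrt : r ≠ t)
    (h1 : D.curve r = D.curve s) (h2 : D.curve s = D.curve t) : False := by
  have key : ∀ a b c : ℝ, a ∈ Ico (0 : ℝ) 1 → c ∈ Ico (0 : ℝ) 1 → a < b → b < c →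
      D.curve a = D.curve b → D.curve b = D.curve c → False := fun a b c ha hc hab hbc e1 e2 =>
    D.no_triple a b c hab hbc (by linarith [ha.1, hc.2]) ⟨e1, e2⟩
  rcases lt_or_gt_of_ne hrs with a | a <;> rcases lt_or_gt_of_ne hst with b | b <;>
    rcases lt_or_gt_of_ne hrt with c | c
  · exact key r s t hr ht a b h1 h2
  · linarith
  · exact key r t s hr hs c b (h1.trans h2) h2.symm
  · exact key t r s ht hs c a (h1.trans h2).symm h1
  · exact key s r t hs ht a c h1.symm (h1.trans h2)
  · exact key s t r hs hr b c h2 (h1.trans h2).symm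
  · linarith
  · exact key t s r ht hr b a h2.symm h1.symm

/-- Distinct crossings have no parameter in common. -/
theorem crossing_params_ne {c d : ℝ × ℝ} (hc : c ∈ D.crossingFinset) (hd : d ∈ D.crossingFinset)
    (hcd : c ≠ d) : c.1 ≠ d.1 ∧ c.1 ≠ d.2 ∧ c.2 ≠ d.1 ∧ c.2 ≠ d.2 := by
  rw [mem_crossingFinset] at hc hd
  obtain ⟨c1, c2⟩ := c
  obtain ⟨d1, d2⟩ := d
  obtain ⟨hc0, hc1, hc2, hc3⟩ := hc
  obtain ⟨hd0, hd1, hd2, hd3⟩ := hd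
  simp only at *
  have m1 : c1 ∈ Ico (0 : ℝ) 1 := ⟨hc0, by linarith⟩
  have m2 : c2 ∈ Ico (0 : ℝ) 1 := ⟨by linarith, by linarith⟩
  have m3 : d1 ∈ Ico (0 : ℝ) 1 := ⟨hd0, by linarith⟩
  have m4 : d2 ∈ Ico (0 : ℝ) 1 := ⟨by linarith, by linarith⟩
  refine ⟨?_, ?_, ?_, ?_⟩
  · rintro rfl
    by_cases h : c2 = d2
    · exact hcd (by rw [h])
    · exact D.eq_of_curve_eq m2 m1 m4 hc1.ne' hd1.ne h hc3.symm hd3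
  · rintro rfl
    exact D.eq_of_curve_eq m2 m1 m3 hc1.ne' hd1.ne' (by linarith) hc3.symm hd3.symm
  · rintro rfl
    exact D.eq_of_curve_eq m1 m2 m4 hc1.ne hd1.ne (by linarith) hc3 hd3
  · rintro rfl
    by_cases h : c1 = d1
    · exact hcd (by rw [h])
    · exact D.eq_of_curve_eq m1 m2 m3 hc1.ne hd1.ne' h hc3 hd3.symm

end KnotDiagram

namespace KnotDiagram

/-! ### Invariance under equivalence -/

/-- By the chain rule the velocities of `E` are, up to positive factors, the images of those of `D`
under the derivative of `Φ`. The hypothesis `hor` speaks of positive frames only, so a negative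
frame is first swapped. -/
theorem sign_eq_of_deriv {D E : KnotDiagram} {h : ℝ → ℝ} {Φ : (Fin 3 → ℝ) → (Fin 3 → ℝ)}
    (hh : ContDiff ℝ ∞ h) (hpos : ∀ t, 0 < deriv h t) (hΦ : ContDiff ℝ ∞ Φ)
    (hor : ∀ p ∈ unitSphere, ∀ a b : Fin 3 → ℝ, dotProduct p a = 0 → dotProduct p b = 0 →
      0 < tripleProduct p a b → 0 < tripleProduct (Φ p) (fderiv ℝ Φ p a) (fderiv ℝ Φ p b))
    (hcurve : ∀ t, E.curve (h t) = Φ (D.curve t)) {s t : ℝ} (h1 : s < t) (h2 : t < s + 1)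
    (hst : D.curve s = D.curve t) :
    SignType.sign (tripleProduct (E.curve (h s)) (deriv E.curve (h s)) (deriv E.curve (h t))) =
      SignType.sign (tripleProduct (D.curve s) (deriv D.curve s) (deriv D.curve t)) := by
  have hder : ∀ u, deriv h u • deriv E.curve (h u) = fderiv ℝ Φ (D.curve u) (deriv D.curve u) := by
    intro u
    have e1 : HasDerivAt (fun u => E.curve (h u)) (deriv h u • deriv E.curve (h u)) u :=
      (E.differentiable (h u)).hasDerivAt.scomp u
        ((hh.differentiable (by simp)) u).hasDerivAt
    have e2 : HasDerivAt (fun u => Φ (D.curve u)) (fderiv ℝ Φ (D.curve u) (deriv D.curve u)) u :=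
      ((hΦ.differentiable (by simp)) (D.curve u)).hasFDerivAt.comp_hasDerivAt u
        (D.differentiable u).hasDerivAt
    have : (fun u => E.curve (h u)) = fun u => Φ (D.curve u) := funext hcurve
    rw [this] at e1
    exact e1.unique e2
  set T := tripleProduct (E.curve (h s)) (deriv E.curve (h s)) (deriv E.curve (h t))
  have key : deriv h s * deriv h t * T = tripleProduct (Φ (D.curve s))
      (fderiv ℝ Φ (D.curve s) (deriv D.curve s)) (fderiv ℝ Φ (D.curve s) (deriv D.curve t)) := by
    rw [← hder s, hst, ← hder t, tripleProduct_smul_smul, ← hst, ← hcurve]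
  have hm := mul_pos (hpos s) (hpos t)
  have ds := D.dotProduct_deriv s
  have dt := D.dotProduct_deriv t
  rw [← hst] at dt
  rcases lt_or_gt_of_ne (D.tripleProduct_deriv_ne_zero h1 h2 hst) with hn | hp
  · have := hor _ (D.mem_sphere s) _ _ dt ds (by rw [tripleProduct_swap]; linarith)
    rw [tripleProduct_swap, ← key] at this
    have hT : T < 0 := by
      by_contra hc
      nlinarith [mul_nonneg hm.le (not_lt.mp hc)]
    rw [sign_neg hT, sign_neg hn]
  · have := hor _ (D.mem_sphere s) _ _ ds dt hp
    rw [← key] at this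
    rw [sign_pos ((mul_pos_iff_of_pos_left hm).mp this), sign_pos hp]

/-- The pair with entries `s`, `t` in increasing order. -/
noncomputable def sortPair (s t : ℝ) : ℝ × ℝ := (min s t, max s t)

/-- The parity criterion on the right is unaffected by exchanging `s` with `t` or `u` with `v`, so
it can be used without knowing how the pairs get sorted. -/
theorem interleaved_sortPair_iff {s t u v : ℝ} (hst : s ≠ t) (huv : u ≠ v)
    (h11 : s ≠ u) (h12 : s ≠ v) (h21 : t ≠ u) (h22 : t ≠ v) :
    Interleaved (sortPair s t) (sortPair u v) ↔ ¬ ((s < u ↔ t < u) ↔ (s < v ↔ t < v)) := by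
  unfold sortPair
  rcases lt_or_gt_of_ne hst with a | a <;> rcases lt_or_gt_of_ne huv with b | b
  all_goals
    first
    | rw [min_eq_left a.le, max_eq_right a.le]
    | rw [min_eq_right a.le, max_eq_left a.le]
    first
    | rw [min_eq_left b.le, max_eq_right b.le]
    | rw [min_eq_right b.le, max_eq_left b.le]
    rw [interleaved_iff_of_ne a b (by assumption) (by assumption) (by assumption) (by assumption)]
    try tauto

/-- A lift of a homeomorphism of the circle preserves the cyclic order of parameters. -/
theorem fract_lt_fract_iff {h : ℝ → ℝ} (hmono : StrictMono h) (hper : ∀ t, h (t + 1) = h t + 1) :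
    ∃ k : ℝ → Prop, ∀ s ∈ Ico (0 : ℝ) 1, ∀ t ∈ Ico (0 : ℝ) 1, s ≠ t →
      (Int.fract (h s) < Int.fract (h t) ↔ ((s < t) ↔ (k s ↔ k t))) := by
  -- The predicate says that `h s` has not yet reached the next integer after `⌊h 0⌋`. Taking
  -- fractional parts exchanges the block before this integer with the block after it: the order is
  -- kept within a block and reversed between blocks.
  refine ⟨fun s => h s < ⌊h 0⌋ + 1, fun s hs t ht hst => ?_⟩
  have h1 : h 1 = h 0 + 1 := by simpa using hper 0
  have range : ∀ u ∈ Ico (0 : ℝ) 1, h 0 ≤ h u ∧ h u < h 0 + 1 := fun u hu =>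
    ⟨hmono.monotone hu.1, h1 ▸ hmono hu.2⟩
  have f0 := Int.floor_le (h 0)
  have f1 := Int.lt_floor_add_one (h 0)
  have fr : ∀ u ∈ Ico (0 : ℝ) 1, (h u < ⌊h 0⌋ + 1 → Int.fract (h u) = h u - ⌊h 0⌋) ∧
      (¬ h u < ⌊h 0⌋ + 1 → Int.fract (h u) = h u - ⌊h 0⌋ - 1) := by
    intro u hu
    obtain ⟨r0, r1⟩ := range u hu
    constructor
    · intro hlt
      rw [Int.fract, (Int.floor_eq_iff (z := ⌊h 0⌋)).mpr ⟨by linarith, by linarith⟩]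
    · intro hlt
      rw [Int.fract, (Int.floor_eq_iff (z := ⌊h 0⌋ + 1)).mpr
        ⟨by push_cast; linarith, by push_cast; linarith⟩]
      push_cast; ring
  obtain ⟨a0, a1⟩ := range s hs
  obtain ⟨b0, b1⟩ := range t ht
  rw [← hmono.lt_iff_lt (a := s) (b := t)]
  by_cases ks : h s < ⌊h 0⌋ + 1 <;> by_cases kt : h t < ⌊h 0⌋ + 1
  · rw [(fr s hs).1 ks, (fr t ht).1 kt]; simp [ks, kt]
  · rw [(fr s hs).1 ks, (fr t ht).2 kt]
    have : h s < h t := by linarith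
    simp [ks, kt, this]; linarith
  · rw [(fr s hs).2 ks, (fr t ht).1 kt]
    have : ¬ h s < h t := by linarith
    simp [ks, kt, this]; linarith
  · rw [(fr s hs).2 ks, (fr t ht).2 kt]; simp [ks, kt]

theorem iff_iff_cancel (a b k : Prop) : ((a ↔ k) ↔ (b ↔ k)) ↔ (a ↔ b) := by
  by_cases k <;> by_cases a <;> by_cases b <;> simp_all

/-- Equivalence of propositions is addition modulo `2`. In the parity criterion for interleaving
each parameter occurs in two comparisons, so the correction terms of `fract_lt_fract_iff` cancel. -/
theorem iff_twist_cancel (a b k l m : Prop) :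
    ((a ↔ (k ↔ m)) ↔ (b ↔ (l ↔ m))) ↔ ((a ↔ b) ↔ (k ↔ l)) := by
  by_cases k <;> by_cases l <;> by_cases m <;> by_cases a <;> by_cases b <;> simp_all

/-- The map applies the induced circle map, the fractional part of `h`, to both parameters and then
sorts them, since passing the base point can reverse their order. -/
theorem Equivalent.exists_crossing_bijection {D E : KnotDiagram} (hDE : Equivalent D E) :
    ∃ F : ℝ × ℝ → ℝ × ℝ, InjOn F D.crossingFinset ∧
      E.crossingFinset = D.crossingFinset.image F ∧
      (∀ c ∈ D.crossingFinset, E.crossingSign (F c).1 (F c).2 = D.crossingSign c.1 c.2) ∧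
      ∀ c ∈ D.crossingFinset, ∀ d ∈ D.crossingFinset,
        Interleaved (F c) (F d) ↔ Interleaved c d := by
  obtain ⟨h, Φ, hh, hpos, hper, hΦ, hbij, hor, hcurve, hover⟩ := hDE
  have hmono : StrictMono h := strictMono_of_deriv_pos hpos
  have h1 : h 1 = h 0 + 1 := by simpa using hper 0
  obtain ⟨k, hk⟩ := fract_lt_fract_iff hmono hper
  set φ : ℝ → ℝ := fun s => Int.fract (h s) with hφ
  have φmem : ∀ s, φ s ∈ Ico (0 : ℝ) 1 := fun s => ⟨Int.fract_nonneg _, Int.fract_lt_one _⟩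
  have φinj : ∀ s ∈ Ico (0 : ℝ) 1, ∀ t ∈ Ico (0 : ℝ) 1, φ s = φ t → s = t := by
    intro s hs t ht e
    by_contra hne
    have a := hk s hs t ht hne
    have b := hk t ht s hs (Ne.symm hne)
    have e1 : ¬ Int.fract (h s) < Int.fract (h t) := by
      rw [show Int.fract (h s) = Int.fract (h t) from e]; exact lt_irrefl _
    have e2 : ¬ Int.fract (h t) < Int.fract (h s) := by
      rw [show Int.fract (h s) = Int.fract (h t) from e]; exact lt_irrefl _
    rcases lt_or_gt_of_ne hne with c | c
    · have : ¬ t < s := not_lt_of_gt c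
      tauto
    · have : ¬ s < t := not_lt_of_gt c
      tauto
  have φsurj : ∀ u ∈ Ico (0 : ℝ) 1, ∃ s ∈ Ico (0 : ℝ) 1, φ s = u := by
    intro u hu
    have hc : ContinuousOn h (Icc 0 1) := hh.continuous.continuousOn
    -- The shift by `⌈h 0 - u⌉` moves `u` into the period `[h 0, h 1)`, where the intermediate value
    -- theorem applies.
    have m1 := Int.le_ceil (h 0 - u)
    have m2 := Int.ceil_lt_add_one (h 0 - u)
    obtain ⟨s, hs, e⟩ := intermediate_value_Ico zero_le_one hc
      (show u + ⌈h 0 - u⌉ ∈ Ico (h 0) (h 1) from ⟨by linarith, by linarith⟩)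
    refine ⟨s, hs, ?_⟩
    simp only [hφ, e, Int.fract_add_intCast]
    exact Int.fract_eq_self.mpr hu
  have φeq : ∀ s, φ s = h s + (-⌊h s⌋ : ℤ) := fun s => by
    simp only [hφ, Int.fract]; push_cast; ring
  have φcurve : ∀ s, E.curve (φ s) = Φ (D.curve s) := fun s => by
    rw [φeq, E.curve_add_int, hcurve]
  have curve_iff : ∀ s t, E.curve (φ s) = E.curve (φ t) ↔ D.curve s = D.curve t := fun s t => by
    rw [φcurve, φcurve]
    exact hbij.injOn.eq_iff (D.mem_sphere s) (D.mem_sphere t)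
  have sign_eq : ∀ s t, s < t → t < s + 1 → D.curve s = D.curve t →
      E.crossingSign (φ s) (φ t) = D.crossingSign s t := by
    intro s t a b e
    have key := sign_eq_of_deriv hh hpos hΦ hor hcurve a b e
    rw [φeq s, φeq t, E.crossingSign_add_int]
    unfold crossingSign
    simp only [tripleProduct_swap (E.curve (h s)) (deriv E.curve (h s)) (deriv E.curve (h t)),
      tripleProduct_swap (D.curve s) (deriv D.curve s) (deriv D.curve t), Left.sign_neg, key]
    by_cases o : s ∈ D.overSet <;> simp [o, hover]
  refine ⟨fun c => sortPair (φ c.1) (φ c.2), ?_, ?_, ?_, ?_⟩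
  · intro c hc d hd e
    by_contra hne
    obtain ⟨n1, n2, -, -⟩ := D.crossing_params_ne hc hd hne
    rw [Finset.mem_coe, mem_crossingFinset] at hc hd
    obtain ⟨hc0, hc1, hc2, hc3⟩ := hc
    obtain ⟨hd0, hd1, hd2, hd3⟩ := hd
    have mc1 : c.1 ∈ Ico (0 : ℝ) 1 := ⟨hc0, by linarith⟩
    have md1 : d.1 ∈ Ico (0 : ℝ) 1 := ⟨hd0, by linarith⟩
    have md2 : d.2 ∈ Ico (0 : ℝ) 1 := ⟨by linarith, by linarith⟩
    simp only [sortPair, Prod.mk.injEq] at e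
    have : φ c.1 = φ d.1 ∨ φ c.1 = φ d.2 := by
      rcases le_total (φ c.1) (φ c.2) with a | a <;> rcases le_total (φ d.1) (φ d.2) with b | b <;>
        simp only [min_eq_left, min_eq_right, max_eq_left, max_eq_right, a, b] at e <;> tauto
    rcases this with a | a
    · exact n1 (φinj _ mc1 _ md1 a)
    · exact n2 (φinj _ mc1 _ md2 a)
  · ext e
    rw [Finset.mem_image]
    constructor
    · intro he
      rw [mem_crossingFinset] at he
      obtain ⟨e0, e1, e2, e3⟩ := he
      obtain ⟨s, hs, es⟩ := φsurj e.1 ⟨e0, by linarith⟩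
      obtain ⟨t, ht, et⟩ := φsurj e.2 ⟨by linarith, by linarith⟩
      have hcv : D.curve s = D.curve t := by rw [← curve_iff, es, et, e3]
      have hst : s ≠ t := by rintro rfl; linarith
      rcases lt_or_gt_of_ne hst with a | a
      · refine ⟨(s, t), (D.mem_crossingFinset _).mpr ⟨hs.1, a, ht.2, hcv⟩, ?_⟩
        simp only [sortPair, es, et, min_eq_left e1.le, max_eq_right e1.le]
      · refine ⟨(t, s), (D.mem_crossingFinset _).mpr ⟨ht.1, a, hs.2, hcv.symm⟩, ?_⟩
        simp only [sortPair, es, et, min_eq_right e1.le, max_eq_left e1.le]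
    · rintro ⟨c, hc, rfl⟩
      rw [mem_crossingFinset] at hc ⊢
      obtain ⟨c0, c1, c2, c3⟩ := hc
      have hne : φ c.1 ≠ φ c.2 := fun a =>
        c1.ne (φinj _ ⟨c0, by linarith⟩ _ ⟨by linarith, by linarith⟩ a)
      refine ⟨le_min (φmem _).1 (φmem _).1, min_lt_max.mpr hne, max_lt (φmem _).2 (φmem _).2, ?_⟩
      have := (curve_iff c.1 c.2).mpr c3
      simp only [sortPair]
      rcases le_total (φ c.1) (φ c.2) with a | a
      · rw [min_eq_left a, max_eq_right a, this]
      · rw [min_eq_right a, max_eq_left a, this]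
  · intro c hc
    rw [mem_crossingFinset] at hc
    obtain ⟨c0, c1, c2, c3⟩ := hc
    rw [← sign_eq c.1 c.2 c1 (by linarith) c3]
    have := (curve_iff c.1 c.2).mpr c3
    simp only [sortPair]
    rcases le_total (φ c.1) (φ c.2) with a | a
    · rw [min_eq_left a, max_eq_right a]
    · rw [min_eq_right a, max_eq_left a]
      exact E.crossingSign_comm (φmem _) (φmem _) this
  · intro c hc d hd
    by_cases hcd : c = d
    · subst hcd; simp [not_interleaved_self]
    obtain ⟨n1, n2, n3, n4⟩ := D.crossing_params_ne hc hd hcd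
    rw [mem_crossingFinset] at hc hd
    obtain ⟨hc0, hc1, hc2, hc3⟩ := hc
    obtain ⟨hd0, hd1, hd2, hd3⟩ := hd
    have mc1 : c.1 ∈ Ico (0 : ℝ) 1 := ⟨hc0, by linarith⟩
    have mc2 : c.2 ∈ Ico (0 : ℝ) 1 := ⟨by linarith, by linarith⟩
    have md1 : d.1 ∈ Ico (0 : ℝ) 1 := ⟨hd0, by linarith⟩
    have md2 : d.2 ∈ Ico (0 : ℝ) 1 := ⟨by linarith, by linarith⟩
    have ne : ∀ {s t}, s ∈ Ico (0 : ℝ) 1 → t ∈ Ico (0 : ℝ) 1 → s ≠ t → φ s ≠ φ t :=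
      fun hs ht hn a => hn (φinj _ hs _ ht a)
    rw [interleaved_sortPair_iff (ne mc1 mc2 hc1.ne) (ne md1 md2 hd1.ne) (ne mc1 md1 n1)
      (ne mc1 md2 n2) (ne mc2 md1 n3) (ne mc2 md2 n4), interleaved_iff_of_ne hc1 hd1 n1 n2 n3 n4,
      hk _ mc1 _ md1 n1, hk _ mc1 _ md2 n2, hk _ mc2 _ md1 n3, hk _ mc2 _ md2 n4]
    rw [iff_twist_cancel, iff_twist_cancel, iff_iff_cancel]

theorem Equivalent.numCrossings_eq {D E : KnotDiagram} (h : Equivalent D E) :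
    E.numCrossings = D.numCrossings := by
  obtain ⟨F, hinj, himg, -, -⟩ := h.exists_crossing_bijection
  rw [numCrossings_eq_card, numCrossings_eq_card, himg, Finset.card_image_of_injOn hinj]

theorem Equivalent.writhe_eq {D E : KnotDiagram} (h : Equivalent D E) :
    E.writhe = D.writhe := by
  obtain ⟨F, hinj, himg, hsign, -⟩ := h.exists_crossing_bijection
  unfold writhe
  rw [himg, Finset.sum_image hinj]
  exact Finset.sum_congr rfl hsign

theorem Equivalent.cowrithe_eq {D E : KnotDiagram} (h : Equivalent D E) :
    E.cowrithe = D.cowrithe := by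
  obtain ⟨F, hinj, himg, hsign, hint⟩ := h.exists_crossing_bijection
  have : 2 * E.cowrithe = 2 * D.cowrithe := by
    rw [cowrithe_eq_interleavedSum, cowrithe_eq_interleavedSum, two_mul_interleavedSum,
      two_mul_interleavedSum, himg, Finset.sum_image hinj]
    refine Finset.sum_congr rfl fun c hc => ?_
    rw [hsign c hc]
    congr 1
    unfold linkSum
    rw [Finset.sum_image hinj]
    refine Finset.sum_congr rfl fun d hd => ?_
    simp only [hsign d hd]
    have := hint d hd c hc
    by_cases hi : Interleaved d c <;> simp_all
  omega

theorem Equivalent.minusInvariant_eq {D E : KnotDiagram} (h : Equivalent D E) :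
    E.minusInvariant = D.minusInvariant := by
  unfold minusInvariant
  rw [h.numCrossings_eq, h.writhe_eq, h.cowrithe_eq]

theorem Equivalent.plusInvariant_eq {D E : KnotDiagram} (h : Equivalent D E) :
    E.plusInvariant = D.plusInvariant := by
  unfold plusInvariant
  rw [h.numCrossings_eq, h.writhe_eq, h.cowrithe_eq]

end KnotDiagram

/-! ### Real functions near their zeros -/

theorem pos_of_ne_zero_left {f : ℝ → ℝ} (hf : Continuous f) {a c : ℝ} (ha : 0 < f a)
    (h : ∀ t ∈ Ico a c, f t ≠ 0) : ∀ t ∈ Ico a c, 0 < f t := by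
  intro t ht
  by_contra hn
  obtain ⟨u, hu, e⟩ := intermediate_value_Icc' ht.1 hf.continuousOn
    (show (0 : ℝ) ∈ Icc (f t) (f a) from ⟨not_lt.mp hn, ha.le⟩)
  exact h u ⟨hu.1, hu.2.trans_lt ht.2⟩ e

theorem pos_of_ne_zero_right {f : ℝ → ℝ} (hf : Continuous f) {b c : ℝ} (hb : 0 < f b)
    (h : ∀ t ∈ Ioc c b, f t ≠ 0) : ∀ t ∈ Ioc c b, 0 < f t := by
  intro t ht
  by_contra hn
  obtain ⟨u, hu, e⟩ := intermediate_value_Icc ht.2 hf.continuousOn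
    (show (0 : ℝ) ∈ Icc (f t) (f b) from ⟨not_lt.mp hn, hb.le⟩)
  exact h u ⟨ht.1.trans_le hu.1, hu.2⟩ e

/-- One-sided difference quotients give only a weak inequality. Where it is used at a crossing,
transversality makes it strict. -/
theorem deriv_nonneg_of_pos_right {f : ℝ → ℝ} {b c : ℝ} (hf : DifferentiableAt ℝ f c) (hcb : c < b)
    (hc : f c = 0) (h : ∀ t ∈ Ioo c b, 0 < f t) : 0 ≤ deriv f c := by
  have h1 := hf.hasDerivAt.hasDerivWithinAt (s := Ioi c)
  rw [hasDerivWithinAt_iff_tendsto_slope' (by simp)] at h1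
  refine ge_of_tendsto h1 ?_
  filter_upwards [Ioo_mem_nhdsGT hcb] with t ht
  rw [slope_def_field, hc, sub_zero]
  exact div_nonneg (h t ht).le (by linarith [ht.1])

theorem deriv_nonpos_of_pos_left {f : ℝ → ℝ} {a c : ℝ} (hf : DifferentiableAt ℝ f c) (hac : a < c)
    (hc : f c = 0) (h : ∀ t ∈ Ioo a c, 0 < f t) : deriv f c ≤ 0 := by
  have h1 := hf.hasDerivAt.hasDerivWithinAt (s := Iio c)
  rw [hasDerivWithinAt_iff_tendsto_slope' (by simp)] at h1
  refine le_of_tendsto h1 ?_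
  filter_upwards [Ioo_mem_nhdsLT hac] with t ht
  rw [slope_def_field, hc, sub_zero]
  exact div_nonpos_of_nonneg_of_nonpos (h t ht).le (by linarith [ht.2])

/-- A continuous injective function on an interval is strictly monotone. The integer `σ` records in
which direction a strand runs along its axis. -/
theorem exists_sign_of_injOn {f : ℝ → ℝ} (hf : Differentiable ℝ f) {a b : ℝ} (hab : a < b)
    (hinj : InjOn f (Icc a b)) :
    ∃ σ : ℤ, (σ = 1 ∨ σ = -1) ∧
      (∀ s ∈ Icc a b, ∀ t ∈ Icc a b, (s < t ↔ σ * f s < σ * f t)) ∧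
      ∀ t ∈ Ioo a b, 0 ≤ σ * deriv f t := by
  rcases hf.continuous.continuousOn.strictMonoOn_of_injOn_Icc' hab.le hinj with h | h
  · refine ⟨1, Or.inl rfl, fun s hs t ht => by simpa using (h.lt_iff_lt hs ht).symm,
      fun t ht => ?_⟩
    have : 0 ≤ derivWithin f (Icc a b) t := h.monotoneOn.derivWithin_nonneg
    rw [derivWithin_of_mem_nhds (Icc_mem_nhds ht.1 ht.2)] at this
    simpa using this
  · refine ⟨-1, Or.inr rfl, fun s hs t ht => by simpa using (h.lt_iff_gt ht hs).symm,
      fun t ht => ?_⟩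
    have : derivWithin f (Icc a b) t ≤ 0 := h.antitoneOn.derivWithin_nonpos
    rw [derivWithin_of_mem_nhds (Icc_mem_nhds ht.1 ht.2)] at this
    simpa using this

theorem deriv_eq_zero_of_eqOn {f : ℝ → ℝ} {a b : ℝ} (h : ∀ t ∈ Icc a b, f t = 0) :
    ∀ t ∈ Ioo a b, deriv f t = 0 := by
  intro t ht
  have : f =ᶠ[nhds t] fun _ => 0 := by
    filter_upwards [Icc_mem_nhds ht.1 ht.2] with u hu using h u hu
  rw [this.deriv_eq, deriv_const]

/-! ### Crossings in and outside the disc of a local change -/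

/-- The determinant of two vectors of the plane. -/
def planeDet (a b : ℝ × ℝ) : ℝ := a.1 * b.2 - a.2 * b.1

theorem planeDet_swap (a b : ℝ × ℝ) : planeDet b a = -planeDet a b := by
  unfold planeDet; ring

namespace LocalChange

variable {k : ℕ} {D D' : KnotDiagram} (L : LocalChange k D D')

/-- The parameter `t` is not inside any of the arcs. -/
def IsOuter (t : ℝ) : Prop := ∀ i, t ∉ Ioo (L.start i) (L.finish i)

theorem index_unique {i j : Fin k} {t : ℝ} (hi : t ∈ L.arc i) (hj : t ∈ L.arc j) : i = j := by
  rcases lt_trichotomy i j with h | h | h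
  · linarith [L.ordered i j h, hi.2, hj.1]
  · exact h
  · linarith [L.ordered j i h, hj.2, hi.1]

theorem ne_of_index_ne {i j : Fin k} (h : i ≠ j) {s t : ℝ} (hs : s ∈ L.arc i)
    (ht : t ∈ L.arc j) : s ≠ t := by
  rintro rfl
  exact h (L.index_unique hs ht)

theorem lt_of_index_lt {i j : Fin k} (h : i < j) {s t : ℝ} (hs : s ∈ L.arc i)
    (ht : t ∈ L.arc j) : s < t := by
  linarith [hs.2, ht.1, L.ordered i j h]

theorem arc_subset (i : Fin k) {t : ℝ} (h : t ∈ L.arc i) : t ∈ Ico (0 : ℝ) 1 :=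
  ⟨(L.start_pos i).le.trans h.1, h.2.trans_lt (L.finish_lt_one i)⟩

theorem mem_arc_of_Ioo {i : Fin k} {t : ℝ} (h : t ∈ Ioo (L.start i) (L.finish i)) : t ∈ L.arc i :=
  Ioo_subset_Icc_self h

theorem start_mem (i : Fin k) : L.start i ∈ L.arc i := left_mem_Icc.mpr (L.start_lt_finish i).le

theorem finish_mem (i : Fin k) : L.finish i ∈ L.arc i := right_mem_Icc.mpr (L.start_lt_finish i).le

theorem isOuter_start (i : Fin k) : L.IsOuter (L.start i) := fun j hj => by
  obtain rfl := L.index_unique (L.start_mem i) (L.mem_arc_of_Ioo hj)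
  exact lt_irrefl _ hj.1

theorem isOuter_finish (i : Fin k) : L.IsOuter (L.finish i) := fun j hj => by
  obtain rfl := L.index_unique (L.finish_mem i) (L.mem_arc_of_Ioo hj)
  exact lt_irrefl _ hj.2

/-- To the right of `L.start i` lies the inside of an arc, so only a left neighbourhood is
available. It stays in `[0, 1)` because the base point is not on an arc. -/
theorem eventually_isOuter_left {i : Fin k} : ∀ᶠ u in nhdsWithin (L.start i) (Iic (L.start i)),
    u ∈ Ico (0 : ℝ) 1 ∧ L.IsOuter u := by
  have h0 : ∀ᶠ u in nhdsWithin (L.start i) (Iic (L.start i)), 0 < u :=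
    nhdsWithin_le_nhds (lt_mem_nhds (L.start_pos i))
  have h1 : ∀ᶠ u in nhdsWithin (L.start i) (Iic (L.start i)), ∀ j,
      u ∉ Ioo (L.start j) (L.finish j) := by
    rw [Filter.eventually_all]
    intro j
    rcases le_or_gt i j with h | h
    · have : L.start i ≤ L.start j := by
        rcases h.eq_or_lt with rfl | h
        · exact le_rfl
        · exact ((L.start_lt_finish i).trans (L.ordered i j h)).le
      filter_upwards [self_mem_nhdsWithin] with u hu hm
      have : u ≤ L.start i := hu
      linarith [hm.1]
    · have := L.ordered j i h
      filter_upwards [nhdsWithin_le_nhds (lt_mem_nhds this)] with u hu hm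
      linarith [hm.2]
  filter_upwards [h0, h1, self_mem_nhdsWithin] with u h0 h1 h2
  have : u ≤ L.start i := h2
  exact ⟨⟨h0.le, by linarith [L.start_lt_finish i, L.finish_lt_one i]⟩, h1⟩

theorem eventually_isOuter_right {t : ℝ} (ht : t ∈ Ico (0 : ℝ) 1) (h : L.IsOuter t)
    (hs : ∀ i, t ≠ L.start i) : ∀ᶠ u in nhdsWithin t (Ici t), u ∈ Ico (0 : ℝ) 1 ∧ L.IsOuter u := by
  have h0 : ∀ᶠ u in nhdsWithin t (Ici t), u < 1 := nhdsWithin_le_nhds (gt_mem_nhds ht.2)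
  have h1 : ∀ᶠ u in nhdsWithin t (Ici t), ∀ j, u ∉ Ioo (L.start j) (L.finish j) := by
    rw [Filter.eventually_all]
    intro j
    rcases lt_or_gt_of_ne (hs j) with h' | h'
    · filter_upwards [nhdsWithin_le_nhds (gt_mem_nhds h')] with u hu hm
      linarith [hm.1]
    · have : L.finish j ≤ t := not_lt.mp fun hc => h j ⟨h', hc⟩
      filter_upwards [self_mem_nhdsWithin] with u hu hm
      have : t ≤ u := hu
      linarith [hm.2]
  filter_upwards [h0, h1, self_mem_nhdsWithin] with u h0 h1 h2
  exact ⟨⟨ht.1.trans h2, h0⟩, h1⟩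

/-- At an end of an arc the curves are known to agree on one side only, which suffices: both are
differentiable, and a one-sided derivative determines the derivative. -/
theorem deriv_agree {t : ℝ} (ht : t ∈ Ico (0 : ℝ) 1) (h : L.IsOuter t) :
    deriv D'.curve t = deriv D.curve t := by
  have key : ∀ s : Set ℝ, UniqueDiffWithinAt ℝ s t →
      (∀ᶠ u in nhdsWithin t s, u ∈ Ico (0 : ℝ) 1 ∧ L.IsOuter u) →
      deriv D'.curve t = deriv D.curve t := by
    intro s hs he
    have h1 := (D'.differentiable t).hasDerivAt.hasDerivWithinAt (s := s)
    have h2 := ((D.differentiable t).hasDerivAt.hasDerivWithinAt (s := s)).congr_of_eventuallyEq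
      (f₁ := D'.curve) (he.mono fun u hu => L.curve_agree u hu.1 hu.2) (L.curve_agree t ht h)
    exact hs.eq_deriv _ h1 h2
  by_cases hs : ∃ i, t = L.start i
  · obtain ⟨i, rfl⟩ := hs
    exact key _ (uniqueDiffWithinAt_Iic _) L.eventually_isOuter_left
  · push Not at hs
    exact key _ (uniqueDiffWithinAt_Ici _) (L.eventually_isOuter_right ht h hs)

theorem crossingSign_agree {s t : ℝ} (hs : s ∈ Ico (0 : ℝ) 1) (ht : t ∈ Ico (0 : ℝ) 1)
    (os : L.IsOuter s) (ot : L.IsOuter t) : D'.crossingSign s t = D.crossingSign s t := by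
  unfold KnotDiagram.crossingSign
  rw [L.deriv_agree hs os, L.deriv_agree ht ot, L.curve_agree s hs os]
  have := L.over_agree s hs os
  by_cases h : s ∈ D.overSet <;> simp [h, this]

open Classical in
/-- The crossings of `D` outside the disc, which are those of `D'` as well. -/
noncomputable def common : Finset (ℝ × ℝ) :=
  D.crossingFinset.filter fun c => L.IsOuter c.1 ∧ L.IsOuter c.2

theorem mem_common (c : ℝ × ℝ) :
    c ∈ L.common ↔ c ∈ D.crossingFinset ∧ L.IsOuter c.1 ∧ L.IsOuter c.2 := by
  simp [common]

theorem mem_common' (c : ℝ × ℝ) :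
    c ∈ L.common ↔ c ∈ D'.crossingFinset ∧ L.IsOuter c.1 ∧ L.IsOuter c.2 := by
  rw [mem_common, D.mem_crossingFinset, D'.mem_crossingFinset]
  refine and_congr_left fun ⟨o1, o2⟩ => ?_
  refine and_congr_right fun h0 => and_congr_right fun h1 => and_congr_right fun h2 => ?_
  rw [L.curve_agree c.1 ⟨h0, h1.trans h2⟩ o1, L.curve_agree c.2 ⟨h0.trans h1.le, h2⟩ o2]

theorem not_mem_common {i : Fin k} {s : ℝ} (hs : s ∈ Ioo (L.start i) (L.finish i)) (t : ℝ) :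
    (s, t) ∉ L.common := fun h => ((L.mem_common _).mp h).2.1 i hs

theorem common_sign (c : ℝ × ℝ) (hc : c ∈ L.common) :
    D'.crossingSign c.1 c.2 = D.crossingSign c.1 c.2 := by
  rw [mem_common, D.mem_crossingFinset] at hc
  obtain ⟨⟨h0, h1, h2, -⟩, o1, o2⟩ := hc
  exact L.crossingSign_agree ⟨h0, h1.trans h2⟩ ⟨h0.trans h1.le, h2⟩ o1 o2

/-- The path `γ` describes the strands of `E` in the coordinates of the chart. -/
structure IsPath (E : KnotDiagram) (γ : ℝ → ℝ × ℝ) : Prop where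
  smooth : ContDiff ℝ ∞ γ
  curve_eq : ∀ i, ∀ t ∈ L.arc i, E.curve t = L.chart (γ t)
  mem_open : ∀ i, ∀ t ∈ Ioo (L.start i) (L.finish i), γ t ∈ Ioo (-1 : ℝ) 1 ×ˢ Ioo (-1 : ℝ) 1
  outside : ∀ t ∈ Ico (0 : ℝ) 1, (∀ i, t ∉ L.arc i) →
    E.curve t ∉ L.chart '' (Icc (-1 : ℝ) 1 ×ˢ Icc (-1 : ℝ) 1)

theorem isPath_old : L.IsPath D L.old := ⟨L.old_smooth, L.old_eq, L.old_mem, L.outside⟩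

theorem isPath_new : L.IsPath D' L.new := by
  refine ⟨L.new_smooth, L.new_eq, L.new_mem, fun t ht h => ?_⟩
  rw [L.curve_agree t ht fun i hi => h i (L.mem_arc_of_Ioo hi)]
  exact L.outside t ht h

variable {L}

/-! ### Strands in the coordinates of the chart -/

namespace IsPath

variable {E : KnotDiagram} {γ : ℝ → ℝ × ℝ} (hγ : L.IsPath E γ)
include hγ

theorem mem_closed {i : Fin k} {t : ℝ} (ht : t ∈ L.arc i) :
    γ t ∈ Icc (-1 : ℝ) 1 ×ˢ Icc (-1 : ℝ) 1 := by
  have h := (show MapsTo γ _ _ from hγ.mem_open i).closure hγ.smooth.continuous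
  rw [closure_Ioo (L.start_lt_finish i).ne, closure_prod_eq, closure_Ioo (by norm_num)] at h
  exact h ht

theorem curve_eq_iff {i j : Fin k} {s t : ℝ} (hs : s ∈ L.arc i) (ht : t ∈ L.arc j) :
    E.curve s = E.curve t ↔ γ s = γ t := by
  rw [hγ.curve_eq i s hs, hγ.curve_eq j t ht, L.chart_injective.eq_iff]

theorem exists_arc {i : Fin k} {s t : ℝ} (hs : s ∈ Ioo (L.start i) (L.finish i))
    (ht : t ∈ Ico (0 : ℝ) 1) (h : E.curve s = E.curve t) : ∃ j, t ∈ L.arc j := by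
  by_contra hn
  push Not at hn
  refine hγ.outside t ht hn ⟨γ s, hγ.mem_closed (L.mem_arc_of_Ioo hs), ?_⟩
  rw [← h, hγ.curve_eq i s (L.mem_arc_of_Ioo hs)]

/-- A point of the knot inside the disc cannot be met by a parameter off the arcs, as those avoid
the closed square. Hence the crossings missing from `L.common` are crossings between strands of the
disc. -/
theorem exists_arcs {c : ℝ × ℝ} (hc : c ∈ E.crossingFinset)
    (ho : ¬ (L.IsOuter c.1 ∧ L.IsOuter c.2)) : ∃ i j, c.1 ∈ L.arc i ∧ c.2 ∈ L.arc j := by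
  rw [E.mem_crossingFinset] at hc
  obtain ⟨h0, h1, h2, h3⟩ := hc
  unfold IsOuter at ho
  rw [not_and_or] at ho
  push Not at ho
  rcases ho with ⟨i, hi⟩ | ⟨j, hj⟩
  · obtain ⟨j, hj⟩ := hγ.exists_arc hi ⟨h0.trans h1.le, h2⟩ h3
    exact ⟨i, j, L.mem_arc_of_Ioo hi, hj⟩
  · obtain ⟨i, hi⟩ := hγ.exists_arc hj ⟨h0, h1.trans h2⟩ h3.symm
    exact ⟨i, j, hi, L.mem_arc_of_Ioo hj⟩

theorem differentiable : Differentiable ℝ γ := hγ.smooth.differentiable (by simp)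

theorem differentiable_fst : Differentiable ℝ fun t => (γ t).1 := hγ.differentiable.fst

theorem differentiable_snd : Differentiable ℝ fun t => (γ t).2 := hγ.differentiable.snd

theorem deriv_fst (t : ℝ) : (deriv γ t).1 = deriv (fun u => (γ u).1) t :=
  ((hasFDerivAt_fst (p := γ t)).comp_hasDerivAt t (hγ.differentiable t).hasDerivAt).deriv.symm

theorem deriv_snd (t : ℝ) : (deriv γ t).2 = deriv (fun u => (γ u).2) t :=
  ((hasFDerivAt_snd (p := γ t)).comp_hasDerivAt t (hγ.differentiable t).hasDerivAt).deriv.symm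

theorem deriv_curve {i : Fin k} {t : ℝ} (ht : t ∈ Ioo (L.start i) (L.finish i)) :
    deriv E.curve t = (deriv γ t).1 • fderiv ℝ L.chart (γ t) (1, 0) +
      (deriv γ t).2 • fderiv ℝ L.chart (γ t) (0, 1) := by
  have h1 : E.curve =ᶠ[nhds t] fun u => L.chart (γ u) := by
    filter_upwards [Icc_mem_nhds ht.1 ht.2] with u hu using hγ.curve_eq i u hu
  have h2 : HasDerivAt (fun u => L.chart (γ u)) (fderiv ℝ L.chart (γ t) (deriv γ t)) t :=
    ((L.chart_smooth.differentiable (by simp)) (γ t)).hasFDerivAt.comp_hasDerivAt t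
      (hγ.differentiable t).hasDerivAt
  rw [h1.deriv_eq, h2.deriv, ← map_smul, ← map_smul, ← map_add]
  congr 1
  ext <;> simp

/-- The triple product is the plane determinant times the triple product of the coordinate frame,
which is positive by `chart_pos`. -/
theorem sign_tripleProduct {i j : Fin k} {s t : ℝ} (hs : s ∈ Ioo (L.start i) (L.finish i))
    (ht : t ∈ Ioo (L.start j) (L.finish j)) (h : E.curve s = E.curve t) :
    SignType.sign (tripleProduct (E.curve s) (deriv E.curve s) (deriv E.curve t)) =
      SignType.sign (planeDet (deriv γ s) (deriv γ t)) := by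
  have e := (hγ.curve_eq_iff (L.mem_arc_of_Ioo hs) (L.mem_arc_of_Ioo ht)).mp h
  rw [hγ.deriv_curve hs, hγ.deriv_curve ht, ← e, tripleProduct_combination, sign_mul,
    hγ.curve_eq i s (L.mem_arc_of_Ioo hs), sign_pos (L.chart_pos (γ s)), mul_one]
  rfl

theorem planeDet_ne_zero {i j : Fin k} {s t : ℝ} (hs : s ∈ Ioo (L.start i) (L.finish i))
    (ht : t ∈ Ioo (L.start j) (L.finish j)) (h : E.curve s = E.curve t) (hst : s ≠ t) :
    planeDet (deriv γ s) (deriv γ t) ≠ 0 := by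
  have s1 := L.arc_subset i (L.mem_arc_of_Ioo hs)
  have t1 := L.arc_subset j (L.mem_arc_of_Ioo ht)
  rcases lt_or_gt_of_ne hst with a | a
  · have h1 := E.tripleProduct_deriv_ne_zero a (by linarith [s1.1, t1.2]) h
    rw [← sign_ne_zero, hγ.sign_tripleProduct hs ht h, sign_ne_zero] at h1
    exact h1
  · have h1 := E.tripleProduct_deriv_ne_zero a (by linarith [t1.1, s1.2]) h.symm
    rw [← sign_ne_zero, hγ.sign_tripleProduct ht hs h.symm, sign_ne_zero, planeDet_swap,
      neg_ne_zero] at h1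
    exact h1

open Classical in
theorem crossingSign_eq {i j : Fin k} {s t : ℝ} (hs : s ∈ Ioo (L.start i) (L.finish i))
    (ht : t ∈ Ioo (L.start j) (L.finish j)) (h : E.curve s = E.curve t) :
    E.crossingSign s t = (if s ∈ E.overSet then 1 else -1) *
      (SignType.sign (planeDet (deriv γ s) (deriv γ t)) : ℤ) := by
  unfold KnotDiagram.crossingSign
  rw [tripleProduct_swap (E.curve s) (deriv E.curve s) (deriv E.curve t), Left.sign_neg,
    hγ.sign_tripleProduct hs ht h]
  split_ifs <;> simp

end IsPath

variable (L)

theorem new_eq_old {i : Fin k} {t : ℝ} (ht : t ∈ L.arc i) (h : L.IsOuter t) :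
    L.new t = L.old t := by
  apply L.chart_injective
  rw [← L.new_eq i t ht, ← L.old_eq i t ht, L.curve_agree t (L.arc_subset i ht) h]

theorem interleaved_iff_of_mem {a b : Fin k} {s s' t t' : ℝ}
    (hs : s ∈ Ioo (L.start a) (L.finish a)) (hs' : s' ∈ Ioo (L.start a) (L.finish a))
    (ht : t ∈ Ioo (L.start b) (L.finish b)) (ht' : t' ∈ Ioo (L.start b) (L.finish b))
    (c : ℝ × ℝ) (hc : c ∈ L.common) : Interleaved c (s, t) ↔ Interleaved c (s', t') := by
  obtain ⟨-, o1, o2⟩ := (L.mem_common c).mp hc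
  have key : ∀ (a : Fin k) (u : ℝ), L.IsOuter u → ∀ x ∈ Ioo (L.start a) (L.finish a),
      ∀ y ∈ Ioo (L.start a) (L.finish a), u < x → u < y := by
    intro a u hu x hx y hy h
    by_contra hn
    exact hu a ⟨hy.1.trans_le (not_lt.mp hn), h.trans hx.2⟩
  have key' : ∀ (a : Fin k) (u : ℝ), L.IsOuter u → ∀ x ∈ Ioo (L.start a) (L.finish a),
      ∀ y ∈ Ioo (L.start a) (L.finish a), x < u → y < u := by
    intro a u hu x hx y hy h
    by_contra hn
    exact hu a ⟨hx.1.trans h, (not_lt.mp hn).trans_lt hy.2⟩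
  unfold Interleaved
  constructor
  · rintro (⟨h1, h2, h3⟩ | ⟨h1, h2, h3⟩)
    · exact Or.inl ⟨key a _ o1 _ hs _ hs' h1, key' a _ o2 _ hs _ hs' h2, key b _ o2 _ ht _ ht' h3⟩
    · exact Or.inr ⟨key' a _ o1 _ hs _ hs' h1, key b _ o1 _ ht _ ht' h2, key' b _ o2 _ ht _ ht' h3⟩
  · rintro (⟨h1, h2, h3⟩ | ⟨h1, h2, h3⟩)
    · exact Or.inl ⟨key a _ o1 _ hs' _ hs h1, key' a _ o2 _ hs' _ hs h2, key b _ o2 _ ht' _ ht h3⟩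
    · exact Or.inr ⟨key' a _ o1 _ hs' _ hs h1, key b _ o1 _ ht' _ ht h2, key' b _ o2 _ ht' _ ht h3⟩

end LocalChange

namespace LocalChange

variable {D D' : KnotDiagram}

/-! ### The first Reidemeister move -/

/-- Both parameters of the new crossing lie inside one arc, so no parameter of another crossing lies
between them and it is interleaved with none. -/
theorem IsRI.change {L : LocalChange 1 D D'} {ε : ℤ} (h : L.IsRI ε) :
    D'.cowrithe = D.cowrithe ∧ D'.numCrossings = D.numCrossings + 1 ∧
      D'.writhe = D.writhe + ε := by
  classical
  obtain ⟨hinj, p, hp, q, hq, hpq, hiff, hε⟩ := h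
  have hC : D.crossingFinset = L.common := by
    ext c
    rw [L.mem_common]
    refine ⟨fun hc => ⟨hc, ?_⟩, fun hc => hc.1⟩
    by_contra ho
    obtain ⟨i, j, hi, hj⟩ := L.isPath_old.exists_arcs hc ho
    rw [Subsingleton.elim i 0] at hi
    rw [Subsingleton.elim j 0] at hj
    obtain ⟨-, h1, -, h3⟩ := (D.mem_crossingFinset c).mp hc
    exact h1.ne (hinj hi hj h3)
  have hp' := L.mem_arc_of_Ioo hp
  have hq' := L.mem_arc_of_Ioo hq
  have hC' : D'.crossingFinset = insert (p, q) L.common := by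
    ext c
    rw [Finset.mem_insert, L.mem_common']
    constructor
    · intro hc
      by_cases ho : L.IsOuter c.1 ∧ L.IsOuter c.2
      · exact Or.inr ⟨hc, ho⟩
      obtain ⟨i, j, hi, hj⟩ := L.isPath_new.exists_arcs hc ho
      rw [Subsingleton.elim i 0] at hi
      rw [Subsingleton.elim j 0] at hj
      obtain ⟨-, h1, -, h3⟩ := (D'.mem_crossingFinset c).mp hc
      obtain ⟨e1, e2⟩ := (hiff _ hi _ hj h1).mp h3
      exact Or.inl (Prod.ext e1 e2)
    · rintro (rfl | hc)
      · exact (D'.mem_crossingFinset _).mpr ⟨(L.arc_subset 0 hp').1, hpq, (L.arc_subset 0 hq').2,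
          (hiff p hp' q hq' hpq).mpr ⟨rfl, rfl⟩⟩
      · exact hc.1
  have hn := L.not_mem_common hp q
  refine ⟨?_, ?_, ?_⟩
  · rw [D'.cowrithe_eq_interleavedSum, D.cowrithe_eq_interleavedSum, hC, hC',
      interleavedSum_insert hn, interleavedSum_congr L.common_sign]
    have : linkSum L.common (fun c => D'.crossingSign c.1 c.2) (p, q) = 0 := by
      refine Finset.sum_eq_zero fun c hc => ?_
      rw [if_neg]
      obtain ⟨-, o1, o2⟩ := (L.mem_common c).mp hc
      rintro (⟨h1, h2, h3⟩ | ⟨h1, h2, h3⟩)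
      · exact o2 0 ⟨hp.1.trans h2, h3.trans hq.2⟩
      · exact o1 0 ⟨hp.1.trans h1, h2.trans hq.2⟩
    rw [this, mul_zero, add_zero]
  · rw [D'.numCrossings_eq_card, D.numCrossings_eq_card, hC, hC', Finset.card_insert_of_notMem hn]
  · unfold KnotDiagram.writhe
    rw [hC, hC', Finset.sum_insert hn, Finset.sum_congr rfl L.common_sign, hε, add_comm]

/-! ### The second Reidemeister move -/

open Classical in
/-- The effect of adding two crossings of opposite signs between two strands. -/
theorem change_of_two_crossings {k : ℕ} {L : LocalChange k D D'} {a b : Fin k} (hab : a < b)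
    {x x' y y' : ℝ}
    (hx : x ∈ Ioo (L.start a) (L.finish a)) (hx' : x' ∈ Ioo (L.start a) (L.finish a))
    (hy : y ∈ Ioo (L.start b) (L.finish b)) (hy' : y' ∈ Ioo (L.start b) (L.finish b))
    (hxx : x ≠ x') (hyy : y ≠ y') (hC : D.crossingFinset = L.common)
    (hC' : D'.crossingFinset = insert (x, y) (insert (x', y') L.common)) {e : ℤ}
    (he : e = 1 ∨ e = -1) (h1 : D'.crossingSign x y = e) (h2 : D'.crossingSign x' y' = -e) :
    D'.cowrithe = D.cowrithe - (if x < x' ↔ y < y' then 1 else 0) ∧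
      D'.numCrossings = D.numCrossings + 2 ∧ D'.writhe = D.writhe := by
  have n2 := L.not_mem_common hx' y'
  have n1 : (x, y) ∉ insert (x', y') L.common := by
    rw [Finset.mem_insert, not_or]
    exact ⟨fun h => hxx (congrArg Prod.fst h), L.not_mem_common hx y⟩
  refine ⟨?_, ?_, ?_⟩
  · rw [D'.cowrithe_eq_interleavedSum, D.cowrithe_eq_interleavedSum, hC, hC',
      interleavedSum_insert n1, interleavedSum_insert n2, linkSum_insert n2,
      interleavedSum_congr L.common_sign,
      linkSum_congr (b' := (x', y')) (fun _ _ => rfl)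
        (L.interleaved_iff_of_mem hx hx' hy hy')]
    -- Both parameters on strand `a` precede both on strand `b`, so the two crossings alternate
    -- exactly when they are met in the same order on both strands.
    have hi : Interleaved (x', y') (x, y) ↔ (x < x' ↔ y < y') := by
      have l1 : x < y' := by linarith [hx.2, hy'.1, L.ordered a b hab]
      have l2 : x' < y := by linarith [hx'.2, hy.1, L.ordered a b hab]
      unfold Interleaved
      simp only [l1, l2, true_and]
      rcases lt_or_gt_of_ne hxx with u | u <;> rcases lt_or_gt_of_ne hyy with v | v <;>
        simp [u, v, not_lt_of_gt u, not_lt_of_gt v]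
    simp only [h1, h2, hi]
    rcases he with rfl | rfl <;> split_ifs <;> ring
  · rw [D'.numCrossings_eq_card, D.numCrossings_eq_card, hC, hC',
      Finset.card_insert_of_notMem n1, Finset.card_insert_of_notMem n2]
  · unfold KnotDiagram.writhe
    rw [hC, hC', Finset.sum_insert n1, Finset.sum_insert n2,
      Finset.sum_congr rfl L.common_sign, h1, h2]
    ring

-- The moving strand crosses the axis once downwards and once upwards, with the same strand on top,
-- so the two signs are opposite. The rest is `change_of_two_crossings`.
open Classical in
theorem IsRII.change {L : LocalChange 2 D D'} {matched : Prop} (h : L.IsRII matched) :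
    D'.cowrithe = D.cowrithe - (if matched then 1 else 0) ∧
      D'.numCrossings = D.numCrossings + 2 ∧ D'.writhe = D.writhe := by
  obtain ⟨⟨level, -, hlevel⟩, i, j, hij, himg, hfix, injI, injJ, injJ', habove, p, hp, q, hq,
    p', hp', q', hq', hpq, hpq', hiff, hmatched⟩ := h
  have ap := L.mem_arc_of_Ioo hp
  have aq := L.mem_arc_of_Ioo hq
  have ap' := L.mem_arc_of_Ioo hp'
  have aq' := L.mem_arc_of_Ioo hq'
  have hN := L.isPath_new
  have hO := L.isPath_old
  have cover : ∀ a : Fin 2, a = i ∨ a = j := by omega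
  have y_zero : ∀ t ∈ L.arc i, (L.old t).2 = 0 := by
    intro t ht
    have : L.old t ∈ Icc (-1 : ℝ) 1 ×ˢ ({0} : Set ℝ) := himg ▸ mem_image_of_mem _ ht
    exact this.2
  have cp : D'.curve p' = D'.curve p := (hiff p' ap' p ap).mpr (Or.inl ⟨rfl, rfl⟩)
  have cq : D'.curve q' = D'.curve q := (hiff q' aq' q aq).mpr (Or.inr ⟨rfl, rfl⟩)
  -- the crossings before and after the move
  have injI' : InjOn D'.curve (L.arc i) := by
    intro s hs t ht e
    rw [hN.curve_eq_iff hs ht, hfix s hs, hfix t ht, ← hO.curve_eq_iff hs ht] at e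
    exact injI hs ht e
  have disj : ∀ s ∈ L.arc i, ∀ t ∈ L.arc j, D.curve s ≠ D.curve t := by
    intro s hs t ht e
    rw [hO.curve_eq_iff hs ht] at e
    have := habove t ht
    rw [← e, y_zero s hs] at this
    exact lt_irrefl _ this
  have hC : D.crossingFinset = L.common := by
    ext c
    rw [L.mem_common]
    refine ⟨fun hc => ⟨hc, ?_⟩, fun hc => hc.1⟩
    by_contra ho
    obtain ⟨a, b, ha, hb⟩ := hO.exists_arcs hc ho
    obtain ⟨-, h1, -, h3⟩ := (D.mem_crossingFinset c).mp hc
    rcases cover a with rfl | rfl <;> rcases cover b with rfl | rfl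
    · exact h1.ne (injI ha hb h3)
    · exact disj _ ha _ hb h3
    · exact disj _ hb _ ha h3.symm
    · exact h1.ne (injJ ha hb h3)
  have new_crossing : ∀ c ∈ D'.crossingFinset, c ∈ L.common ∨
      (c.1 = p' ∧ c.2 = p ∨ c.1 = q' ∧ c.2 = q) ∨ (c.2 = p' ∧ c.1 = p ∨ c.2 = q' ∧ c.1 = q) := by
    intro c hc
    by_cases ho : L.IsOuter c.1 ∧ L.IsOuter c.2
    · exact Or.inl ((L.mem_common' c).mpr ⟨hc, ho⟩)
    refine Or.inr ?_
    obtain ⟨a, b, ha, hb⟩ := hN.exists_arcs hc ho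
    obtain ⟨-, h1, -, h3⟩ := (D'.mem_crossingFinset c).mp hc
    rcases cover a with rfl | rfl <;> rcases cover b with rfl | rfl
    · exact absurd (injI' ha hb h3) h1.ne
    · exact Or.inl ((hiff _ ha _ hb).mp h3)
    · exact Or.inr ((hiff _ hb _ ha).mp h3.symm)
    · exact absurd (injJ' ha hb h3) h1.ne
  -- the signs of the two new crossings
  set f : ℝ → ℝ := fun t => (L.new t).2 with hf
  have fd : Differentiable ℝ f := hN.differentiable_snd
  have f_zero : ∀ t ∈ L.arc j, f t = 0 → t = p ∨ t = q := by
    intro t ht h0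
    have hm : L.new t ∈ Icc (-1 : ℝ) 1 ×ˢ ({0} : Set ℝ) := ⟨(hN.mem_closed ht).1, h0⟩
    rw [← himg] at hm
    obtain ⟨s, hs, e⟩ := hm
    rw [← hfix s hs, ← hN.curve_eq_iff hs ht, hiff s hs t ht] at e
    tauto
  have fp : f p = 0 := by
    have := (hN.curve_eq_iff ap' ap).mp cp
    simp only [hf]
    rw [← this, hfix p' ap', y_zero p' ap']
  have fq : f q = 0 := by
    have := (hN.curve_eq_iff aq' aq).mp cq
    simp only [hf]
    rw [← this, hfix q' aq', y_zero q' aq']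
  have fstart : 0 < f (L.start j) := by
    simp only [hf]
    rw [L.new_eq_old (L.start_mem j) (L.isOuter_start j)]
    exact habove _ (L.start_mem j)
  have ffinish : 0 < f (L.finish j) := by
    simp only [hf]
    rw [L.new_eq_old (L.finish_mem j) (L.isOuter_finish j)]
    exact habove _ (L.finish_mem j)
  -- Strand `j` starts and ends above the axis and meets it only at `p` and `q`, so it comes down at
  -- `p` and goes up at `q`. What happens between them is irrelevant.
  have fp' : deriv f p ≤ 0 := by
    refine deriv_nonpos_of_pos_left (fd p) hp.1 fp fun t ht => ?_
    refine pos_of_ne_zero_left fd.continuous fstart (fun u hu h0 => ?_) t (Ioo_subset_Ico_self ht)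
    have hu2 := hu.2
    rcases f_zero u ⟨hu.1, hu2.le.trans hp.2.le⟩ h0 with rfl | rfl <;> linarith
  have fq' : 0 ≤ deriv f q := by
    refine deriv_nonneg_of_pos_right (fd q) hq.2 fq fun t ht => ?_
    refine pos_of_ne_zero_right fd.continuous ffinish (fun u hu h0 => ?_) t (Ioo_subset_Ioc_self ht)
    have hu1 := hu.1
    rcases f_zero u ⟨hq.1.le.trans hu1.le, hu.2⟩ h0 with rfl | rfl <;> linarith
  have injx : InjOn (fun t => (L.new t).1) (Icc (L.start i) (L.finish i)) := by
    intro s hs t ht e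
    refine injI' hs ht ((hN.curve_eq_iff hs ht).mpr (Prod.ext e ?_))
    rw [hfix s hs, hfix t ht, y_zero s hs, y_zero t ht]
  obtain ⟨σ, hσ, -, hσ'⟩ := exists_sign_of_injOn hN.differentiable_fst (L.start_lt_finish i) injx
  have ydir : ∀ t ∈ Ioo (L.start i) (L.finish i), (deriv L.new t).2 = 0 := fun t ht => by
    rw [hN.deriv_snd]
    exact deriv_eq_zero_of_eqOn (fun u hu => by rw [hfix u hu, y_zero u hu]) t ht
  have det : ∀ s ∈ Ioo (L.start i) (L.finish i), ∀ t, planeDet (deriv L.new s) (deriv L.new t) =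
      deriv (fun u => (L.new u).1) s * deriv f t := fun s hs t => by
    unfold planeDet
    rw [ydir s hs, hN.deriv_fst, hN.deriv_snd]
    ring
  have dp := hN.planeDet_ne_zero hp' hp cp (L.ne_of_index_ne hij ap' ap)
  have dq := hN.planeDet_ne_zero hq' hq cq (L.ne_of_index_ne hij aq' aq)
  rw [det _ hp'] at dp
  rw [det _ hq'] at dq
  have sp := hN.crossingSign_eq hp' hp cp
  have sq := hN.crossingSign_eq hq' hq cq
  rw [det _ hp', sign_mul, sign_neg (lt_of_le_of_ne fp' (right_ne_zero_of_mul dp))] at sp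
  rw [det _ hq', sign_mul, sign_pos (lt_of_le_of_ne fq' (right_ne_zero_of_mul dq).symm)] at sq
  have xsign : ∀ s ∈ Ioo (L.start i) (L.finish i), deriv (fun u => (L.new u).1) s ≠ 0 →
      (SignType.sign (deriv (fun u => (L.new u).1) s) : ℤ) = σ := by
    intro s hs h0
    have := hσ' s hs
    rcases hσ with rfl | rfl
    · rw [sign_pos (lt_of_le_of_ne (by simpa using this) h0.symm)]; rfl
    · rw [sign_neg (lt_of_le_of_ne (by simpa using this) h0)]; rfl
  have hover : p' ∈ D'.overSet ↔ q' ∈ D'.overSet :=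
    ((hlevel i j hij p' ap' p ap).2 cp).trans ((hlevel i j hij q' aq' q aq).2 cq).symm
  rw [SignType.coe_mul, xsign _ hp' (left_ne_zero_of_mul dp)] at sp
  rw [SignType.coe_mul, xsign _ hq' (left_ne_zero_of_mul dq)] at sq
  obtain ⟨e, he, ep, eq⟩ : ∃ e : ℤ, (e = 1 ∨ e = -1) ∧ D'.crossingSign p' p = e ∧
      D'.crossingSign q' q = -e := by
    refine ⟨_, ?_, rfl, ?_⟩
    · rw [sp]
      rcases hσ with rfl | rfl <;> split_ifs <;> simp
    · rw [sp, sq]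
      by_cases o : q' ∈ D'.overSet <;> simp [o, hover]
  have mp := L.arc_subset j ap
  have mq := L.arc_subset j aq
  have mp' := L.arc_subset i ap'
  have mq' := L.arc_subset i aq'
  -- A crossing is stored with its smaller parameter first, so the pairs depend on which of the two
  -- strands is met first.
  rcases lt_or_gt_of_ne hij with hlt | hlt
  · have lt : ∀ s ∈ L.arc i, ∀ t ∈ L.arc j, s < t := fun s hs t ht =>
      L.lt_of_index_lt hlt hs ht
    have hC' : D'.crossingFinset = insert (p', p) (insert (q', q) L.common) := by
      ext c
      rw [Finset.mem_insert, Finset.mem_insert]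
      constructor
      · intro hc
        have h1 := ((D'.mem_crossingFinset c).mp hc).2.1
        rcases new_crossing c hc with h | (⟨e1, e2⟩ | ⟨e1, e2⟩) | (⟨e1, e2⟩ | ⟨e1, e2⟩)
        · exact Or.inr (Or.inr h)
        · exact Or.inl (Prod.ext e1 e2)
        · exact Or.inr (Or.inl (Prod.ext e1 e2))
        · rw [e1, e2] at h1; exact absurd h1 (lt _ ap' _ ap).not_gt
        · rw [e1, e2] at h1; exact absurd h1 (lt _ aq' _ aq).not_gt
      · rintro (rfl | rfl | h)
        · exact (D'.mem_crossingFinset _).mpr ⟨mp'.1, lt _ ap' _ ap, mp.2, cp⟩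
        · exact (D'.mem_crossingFinset _).mpr ⟨mq'.1, lt _ aq' _ aq, mq.2, cq⟩
        · exact ((L.mem_common' c).mp h).1
    have := change_of_two_crossings hlt hp' hq' hp hq hpq' hpq.ne hC hC' he ep eq
    simpa only [hpq, iff_true, ← hmatched] using this
  · have lt : ∀ s ∈ L.arc i, ∀ t ∈ L.arc j, t < s := fun s hs t ht =>
      L.lt_of_index_lt hlt ht hs
    have hC' : D'.crossingFinset = insert (p, p') (insert (q, q') L.common) := by
      ext c
      rw [Finset.mem_insert, Finset.mem_insert]
      constructor
      · intro hc
        have h1 := ((D'.mem_crossingFinset c).mp hc).2.1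
        rcases new_crossing c hc with h | (⟨e1, e2⟩ | ⟨e1, e2⟩) | (⟨e1, e2⟩ | ⟨e1, e2⟩)
        · exact Or.inr (Or.inr h)
        · rw [e1, e2] at h1; exact absurd h1 (lt _ ap' _ ap).not_gt
        · rw [e1, e2] at h1; exact absurd h1 (lt _ aq' _ aq).not_gt
        · exact Or.inl (Prod.ext e2 e1)
        · exact Or.inr (Or.inl (Prod.ext e2 e1))
      · rintro (rfl | rfl | h)
        · exact (D'.mem_crossingFinset _).mpr ⟨mp.1, lt _ ap' _ ap, mp'.2, cp.symm⟩
        · exact (D'.mem_crossingFinset _).mpr ⟨mq.1, lt _ aq' _ aq, mq'.2, cq.symm⟩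
        · exact ((L.mem_common' c).mp h).1
    have := change_of_two_crossings hlt hp hq hp' hq' hpq.ne hpq' hC hC' he
      (by rw [← ep]; exact D'.crossingSign_comm mp' mp cp)
      (by rw [← eq]; exact D'.crossingSign_comm mq' mq cq)
    simpa only [hpq, true_iff, ← hmatched] using this

end LocalChange

/-! ### The third Reidemeister move -/

theorem pos_iff_lt_of_unique_zero {f : ℝ → ℝ} (hf : Differentiable ℝ f) {a b c : ℝ}
    (hc : c ∈ Ioo a b) (ha : 0 < f a) (hb : f b < 0) (h : ∀ t ∈ Icc a b, f t = 0 ↔ t = c) :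
    (∀ t ∈ Icc a b, 0 < f t ↔ t < c) ∧ deriv f c ≤ 0 := by
  have hl : ∀ t ∈ Ico a c, 0 < f t := pos_of_ne_zero_left hf.continuous ha fun t ht h0 =>
    ht.2.ne ((h t ⟨ht.1, ht.2.le.trans hc.2.le⟩).mp h0)
  have hr : ∀ t ∈ Ioc c b, 0 < -f t := pos_of_ne_zero_right (f := fun t => -f t)
    hf.continuous.neg (by simpa using hb) fun t ht h0 =>
      ht.1.ne' ((h t ⟨hc.1.le.trans ht.1.le, ht.2⟩).mp (neg_eq_zero.mp h0))
  have h0 : f c = 0 := (h c (Ioo_subset_Icc_self hc)).mpr rfl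
  refine ⟨fun t ht => ⟨fun hp => ?_, fun hlt => hl t ⟨ht.1, hlt⟩⟩,
    deriv_nonpos_of_pos_left (hf c) hc.1 h0 fun t ht => hl t (Ioo_subset_Ico_self ht)⟩
  by_contra hn
  rcases (not_lt.mp hn).eq_or_lt with rfl | hlt
  · linarith
  · linarith [hr t ⟨hlt, ht.2⟩]

theorem sign_mul_eq {a b : ℝ} {σ τ : ℤ} (hσ : σ = 1 ∨ σ = -1) (hτ : τ = 1 ∨ τ = -1)
    (ha : 0 ≤ σ * a) (hb : 0 ≤ τ * b) (h : a * b ≠ 0) :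
    (SignType.sign (a * b) : ℤ) = σ * τ := by
  have key : ∀ {x : ℝ} {ρ : ℤ}, ρ = 1 ∨ ρ = -1 → 0 ≤ ρ * x → x ≠ 0 →
      (SignType.sign x : ℤ) = ρ := by
    rintro x ρ (rfl | rfl) hx h0
    · rw [sign_pos (lt_of_le_of_ne (by simpa using hx) h0.symm)]; rfl
    · rw [sign_neg (lt_of_le_of_ne (by simpa using hx) h0)]; rfl
  rw [sign_mul, SignType.coe_mul, key hσ ha (left_ne_zero_of_mul h),
    key hτ hb (right_ne_zero_of_mul h)]

/-- The sign of a crossing between strands `a` and `b`, relative to their directions, that is due to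
their heights. -/
def heightSign {k : ℕ} (level : Fin k → ℕ) (a b : Fin k) : ℤ :=
  if level b < level a then 1 else -1

/-- The top strand contributes `1 * 1`, the bottom one `(-1) * (-1)`, and the middle one `-1`. -/
theorem heightSign_sum {level : Fin 3 → ℕ} (h : Function.Injective level) :
    heightSign level 0 1 * heightSign level 0 2 + heightSign level 1 2 * heightSign level 1 0 +
      heightSign level 2 0 * heightSign level 2 1 = 1 := by
  have h01 := h.ne (show (0 : Fin 3) ≠ 1 by decide)
  have h02 := h.ne (show (0 : Fin 3) ≠ 2 by decide)
  have h12 := h.ne (show (1 : Fin 3) ≠ 2 by decide)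
  unfold heightSign
  split_ifs <;> first | rfl | omega

namespace LocalChange

variable {D D' : KnotDiagram} {L : LocalChange 3 D D'}

/-! ### Three strands that cross pairwise -/

namespace IsTriangle

variable {E : KnotDiagram} {cr : Fin 3 → Fin 3 → ℝ} (hT : L.IsTriangle E cr)
include hT

theorem mem_arc {a b : Fin 3} (h : a ≠ b) : cr a b ∈ L.arc a := L.mem_arc_of_Ioo (hT.1 a b h)

theorem curve_eq {a b : Fin 3} (h : a ≠ b) : E.curve (cr a b) = E.curve (cr b a) :=
  (hT.2 a b _ (hT.mem_arc h) _ (hT.mem_arc h.symm)).mpr (Or.inr ⟨h, rfl, rfl⟩)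

theorem injOn (a : Fin 3) : InjOn E.curve (L.arc a) := fun s hs t ht e => by
  rcases (hT.2 a a s hs t ht).mp e with h | h
  · exact h.2
  · exact absurd rfl h.1

/-- Equality would give a triple point. -/
theorem cr_ne {a b c : Fin 3} (hab : a ≠ b) (hbc : b ≠ c) (hca : c ≠ a) : cr a b ≠ cr a c := by
  intro e
  have h1 := hT.curve_eq hab
  have h2 := hT.curve_eq hca.symm
  rw [← e] at h2
  exact E.eq_of_curve_eq (L.arc_subset _ (hT.mem_arc hab.symm)) (L.arc_subset _ (hT.mem_arc hab))
    (L.arc_subset _ (hT.mem_arc hca))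
    (L.ne_of_index_ne hab.symm (hT.mem_arc hab.symm) (hT.mem_arc hab))
    (L.ne_of_index_ne hca.symm (hT.mem_arc hab) (hT.mem_arc hca))
    (L.ne_of_index_ne hbc (hT.mem_arc hab.symm) (hT.mem_arc hca)) h1.symm h2

theorem crossingSign_comm {a b : Fin 3} (h : a ≠ b) :
    E.crossingSign (cr b a) (cr a b) = E.crossingSign (cr a b) (cr b a) :=
  E.crossingSign_comm (L.arc_subset _ (hT.mem_arc h)) (L.arc_subset _ (hT.mem_arc h.symm))
    (hT.curve_eq h)

/-- `L.common` is defined through `D`. The hypothesis `hcommon` lets one argument serve both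
diagrams, by `mem_common` for `D` and `mem_common'` for `D'`. -/
theorem crossingFinset_eq {γ : ℝ → ℝ × ℝ} (hγ : L.IsPath E γ)
    (hcommon : ∀ c, c ∈ L.common ↔ c ∈ E.crossingFinset ∧ L.IsOuter c.1 ∧ L.IsOuter c.2) :
    E.crossingFinset = insert (cr 0 1, cr 1 0) (insert (cr 0 2, cr 2 0)
      (insert (cr 1 2, cr 2 1) L.common)) := by
  have mem : ∀ a b : Fin 3, a < b → (cr a b, cr b a) ∈ E.crossingFinset := fun a b h =>
    (E.mem_crossingFinset _).mpr ⟨(L.arc_subset _ (hT.mem_arc h.ne)).1,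
      L.lt_of_index_lt h (hT.mem_arc h.ne) (hT.mem_arc h.ne'), (L.arc_subset _ (hT.mem_arc h.ne')).2,
      hT.curve_eq h.ne⟩
  ext c
  simp only [Finset.mem_insert]
  constructor
  · intro hc
    by_cases ho : L.IsOuter c.1 ∧ L.IsOuter c.2
    · exact Or.inr (Or.inr (Or.inr ((hcommon c).mpr ⟨hc, ho⟩)))
    obtain ⟨a, b, ha, hb⟩ := hγ.exists_arcs hc ho
    obtain ⟨-, h1, -, h3⟩ := (E.mem_crossingFinset c).mp hc
    rcases (hT.2 a b _ ha _ hb).mp h3 with ⟨-, h⟩ | ⟨hab, e1, e2⟩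
    · exact absurd h h1.ne
    have hlt : a < b := by
      rcases lt_or_gt_of_ne hab with h | h
      · exact h
      · exact absurd (L.lt_of_index_lt h hb ha) h1.not_gt
    have e : c = (cr a b, cr b a) := Prod.ext e1 e2
    fin_cases a <;> fin_cases b <;> simp at hlt <;> simp [e]
  · rintro (rfl | rfl | rfl | h)
    · exact mem 0 1 (by decide)
    · exact mem 0 2 (by decide)
    · exact mem 1 2 (by decide)
    · exact ((hcommon c).mp h).1

-- Two of the three crossings share a strand, and the parameters on different strands are ordered by
-- the arcs. So whether the two are interleaved depends only on their order on the shared strand,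
-- which is what the last three terms record.
open Classical in
theorem counts {γ : ℝ → ℝ × ℝ} (hγ : L.IsPath E γ)
    (hcommon : ∀ c, c ∈ L.common ↔ c ∈ E.crossingFinset ∧ L.IsOuter c.1 ∧ L.IsOuter c.2) :
    E.numCrossings = L.common.card + 3 ∧
    E.writhe = ∑ c ∈ L.common, E.crossingSign c.1 c.2 + E.crossingSign (cr 0 1) (cr 1 0) +
      E.crossingSign (cr 0 2) (cr 2 0) + E.crossingSign (cr 1 2) (cr 2 1) ∧
    E.cowrithe = interleavedSum L.common (fun c => E.crossingSign c.1 c.2) +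
      E.crossingSign (cr 0 1) (cr 1 0) *
        linkSum L.common (fun c => E.crossingSign c.1 c.2) (cr 0 1, cr 1 0) +
      E.crossingSign (cr 0 2) (cr 2 0) *
        linkSum L.common (fun c => E.crossingSign c.1 c.2) (cr 0 2, cr 2 0) +
      E.crossingSign (cr 1 2) (cr 2 1) *
        linkSum L.common (fun c => E.crossingSign c.1 c.2) (cr 1 2, cr 2 1) +
      E.crossingSign (cr 0 1) (cr 1 0) * E.crossingSign (cr 0 2) (cr 2 0) *
        (if cr 0 1 < cr 0 2 then 1 else 0) +
      E.crossingSign (cr 0 1) (cr 1 0) * E.crossingSign (cr 1 2) (cr 2 1) *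
        (if cr 1 2 < cr 1 0 then 1 else 0) +
      E.crossingSign (cr 0 2) (cr 2 0) * E.crossingSign (cr 1 2) (cr 2 1) *
        (if cr 2 0 < cr 2 1 then 1 else 0) := by
  have m01 := hT.mem_arc (show (0 : Fin 3) ≠ 1 by decide)
  have m02 := hT.mem_arc (show (0 : Fin 3) ≠ 2 by decide)
  have m10 := hT.mem_arc (show (1 : Fin 3) ≠ 0 by decide)
  have m12 := hT.mem_arc (show (1 : Fin 3) ≠ 2 by decide)
  have m20 := hT.mem_arc (show (2 : Fin 3) ≠ 0 by decide)
  have m21 := hT.mem_arc (show (2 : Fin 3) ≠ 1 by decide)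
  have n3 : (cr 1 2, cr 2 1) ∉ L.common := L.not_mem_common (hT.1 1 2 (by decide)) _
  have n2 : (cr 0 2, cr 2 0) ∉ insert (cr 1 2, cr 2 1) L.common := by
    rw [Finset.mem_insert, not_or]
    exact ⟨fun h => L.ne_of_index_ne (by decide) m02 m12 (congrArg Prod.fst h),
      L.not_mem_common (hT.1 0 2 (by decide)) _⟩
  have n1 : (cr 0 1, cr 1 0) ∉ insert (cr 0 2, cr 2 0) (insert (cr 1 2, cr 2 1) L.common) := by
    simp only [Finset.mem_insert, not_or]
    exact ⟨fun h => L.ne_of_index_ne (by decide) m10 m20 (congrArg Prod.snd h),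
      fun h => L.ne_of_index_ne (by decide) m01 m12 (congrArg Prod.fst h),
      L.not_mem_common (hT.1 0 1 (by decide)) _⟩
  have hC := hT.crossingFinset_eq hγ hcommon
  refine ⟨?_, ?_, ?_⟩
  · rw [E.numCrossings_eq_card, hC, Finset.card_insert_of_notMem n1,
      Finset.card_insert_of_notMem n2, Finset.card_insert_of_notMem n3]
  · unfold KnotDiagram.writhe
    rw [hC, Finset.sum_insert n1, Finset.sum_insert n2, Finset.sum_insert n3]
    ring
  · have lt : ∀ {s t : ℝ} {a b : Fin 3}, s ∈ L.arc a → t ∈ L.arc b → a < b → s < t :=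
      fun hs ht h => L.lt_of_index_lt h hs ht
    have l1 : Interleaved (cr 0 2, cr 2 0) (cr 0 1, cr 1 0) ↔ cr 0 1 < cr 0 2 := by
      simp [Interleaved, lt m02 m10 (by decide), lt m10 m20 (by decide),
        (lt m10 m20 (by decide)).le]
    have l2 : Interleaved (cr 1 2, cr 2 1) (cr 0 1, cr 1 0) ↔ cr 1 2 < cr 1 0 := by
      simp [Interleaved, lt m01 m12 (by decide), (lt m01 m12 (by decide)).le,
        lt m10 m21 (by decide)]
    have l3 : Interleaved (cr 1 2, cr 2 1) (cr 0 2, cr 2 0) ↔ cr 2 0 < cr 2 1 := by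
      simp [Interleaved, lt m02 m12 (by decide), (lt m02 m12 (by decide)).le,
        lt m12 m20 (by decide)]
    rw [E.cowrithe_eq_interleavedSum, hC, interleavedSum_insert n1, interleavedSum_insert n2,
      interleavedSum_insert n3, linkSum_insert n2, linkSum_insert n3, linkSum_insert n3]
    simp only [l1, l2, l3]
    split_ifs <;> ring

/-- The signs of the crossings in a triangle formed by the two axes and a third strand, and the order
in which they are met. -/
theorem signs_and_order {γ : ℝ → ℝ × ℝ} (hγ : L.IsPath E γ) {level : Fin 3 → ℕ}
    (hlevel : ∀ i j, i ≠ j → ∀ s ∈ L.arc i, ∀ t ∈ L.arc j, E.curve s = E.curve t →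
      (s ∈ E.overSet ↔ level j < level i))
    {i j k : Fin 3} (hij : i ≠ j) (hjk : j ≠ k) (hki : k ≠ i)
    (hi : L.old '' L.arc i = Icc (-1 : ℝ) 1 ×ˢ {0}) (fi : ∀ t ∈ L.arc i, γ t = L.old t)
    (hj : L.old '' L.arc j = {0} ×ˢ Icc (-1 : ℝ) 1) (fj : ∀ t ∈ L.arc j, γ t = L.old t)
    (x_start : (γ (L.start k)).1 < 0) (y_start : 0 < (γ (L.start k)).2)
    (x_finish : 0 < (γ (L.finish k)).1) (y_finish : (γ (L.finish k)).2 < 0)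
    {σ τ : ℤ} (hσ : σ = 1 ∨ σ = -1) (hτ : τ = 1 ∨ τ = -1)
    (oσ : ∀ s ∈ L.arc i, ∀ t ∈ L.arc i, s < t ↔ σ * (L.old s).1 < σ * (L.old t).1)
    (dσ : ∀ t ∈ Ioo (L.start i) (L.finish i), 0 ≤ σ * deriv (fun u => (L.old u).1) t)
    (oτ : ∀ s ∈ L.arc j, ∀ t ∈ L.arc j, s < t ↔ τ * (L.old s).2 < τ * (L.old t).2)
    (dτ : ∀ t ∈ Ioo (L.start j) (L.finish j), 0 ≤ τ * deriv (fun u => (L.old u).2) t) :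
    E.crossingSign (cr i j) (cr j i) = heightSign level i j * (σ * τ) ∧
    E.crossingSign (cr i k) (cr k i) = heightSign level i k * -σ ∧
    E.crossingSign (cr j k) (cr k j) = heightSign level j k * -τ ∧
    (cr i j < cr i k ↔ (σ = 1 ↔ cr k j < cr k i)) ∧
    (cr j i < cr j k ↔ (τ = 1 ↔ cr k j < cr k i)) := by
  have iy : ∀ t ∈ L.arc i, (γ t).2 = 0 := fun t ht => by
    have : L.old t ∈ Icc (-1 : ℝ) 1 ×ˢ ({0} : Set ℝ) := hi ▸ mem_image_of_mem _ ht
    rw [fi t ht]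
    exact this.2
  have jx : ∀ t ∈ L.arc j, (γ t).1 = 0 := fun t ht => by
    have : L.old t ∈ ({0} : Set ℝ) ×ˢ Icc (-1 : ℝ) 1 := hj ▸ mem_image_of_mem _ ht
    rw [fj t ht]
    exact this.1
  have mij := hT.mem_arc hij
  have mji := hT.mem_arc hij.symm
  have mjk := hT.mem_arc hjk
  have mkj := hT.mem_arc hjk.symm
  have mki := hT.mem_arc hki
  have mik := hT.mem_arc hki.symm
  have gij := (hγ.curve_eq_iff mij mji).mp (hT.curve_eq hij)
  have gjk := (hγ.curve_eq_iff mjk mkj).mp (hT.curve_eq hjk)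
  have gik := (hγ.curve_eq_iff mik mki).mp (hT.curve_eq hki.symm)
  have y_zero : ∀ t ∈ Icc (L.start k) (L.finish k), (γ t).2 = 0 ↔ t = cr k i := by
    intro t ht
    constructor
    · intro h0
      have hm : γ t ∈ Icc (-1 : ℝ) 1 ×ˢ ({0} : Set ℝ) := ⟨(hγ.mem_closed ht).1, h0⟩
      rw [← hi] at hm
      obtain ⟨s, hs, e⟩ := hm
      rw [← fi s hs, ← hγ.curve_eq_iff hs ht, hT.2 i k s hs t ht] at e
      rcases e with e | e
      · exact absurd e.1.symm hki
      · exact e.2.2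
    · rintro rfl
      rw [← gik, iy _ mik]
  -- Strand `k` runs from left to right; the minus sign turns this into the passage from positive to
  -- negative required by `pos_iff_lt_of_unique_zero`.
  have x_zero : ∀ t ∈ Icc (L.start k) (L.finish k), -(γ t).1 = 0 ↔ t = cr k j := by
    intro t ht
    rw [neg_eq_zero]
    constructor
    · intro h0
      have hm : γ t ∈ ({0} : Set ℝ) ×ˢ Icc (-1 : ℝ) 1 := ⟨h0, (hγ.mem_closed ht).2⟩
      rw [← hj] at hm
      obtain ⟨s, hs, e⟩ := hm
      rw [← fj s hs, ← hγ.curve_eq_iff hs ht, hT.2 j k s hs t ht] at e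
      rcases e with e | e
      · exact absurd e.1 hjk
      · exact e.2.2
    · rintro rfl
      rw [← gjk, jx _ mjk]
  obtain ⟨y_pos, y_deriv⟩ := pos_iff_lt_of_unique_zero hγ.differentiable_snd (hT.1 k i hki)
    y_start y_finish y_zero
  obtain ⟨x_neg, x_deriv⟩ := pos_iff_lt_of_unique_zero hγ.differentiable_fst.neg
    (hT.1 k j hjk.symm) (by simpa using x_start) (by simpa using x_finish) x_zero
  have x_deriv' : 0 ≤ (deriv γ (cr k j)).1 := by
    have : deriv (fun t => -(γ t).1) (cr k j) ≤ 0 := x_deriv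
    rw [deriv.fun_neg] at this
    rw [hγ.deriv_fst]
    linarith
  rw [← hγ.deriv_snd] at y_deriv
  have di : ∀ t ∈ Ioo (L.start i) (L.finish i), (deriv γ t).2 = 0 ∧ 0 ≤ σ * (deriv γ t).1 := by
    intro t ht
    have e : γ =ᶠ[nhds t] L.old := by
      filter_upwards [Icc_mem_nhds ht.1 ht.2] with u hu using fi u hu
    refine ⟨?_, ?_⟩
    · rw [hγ.deriv_snd]
      exact deriv_eq_zero_of_eqOn iy t ht
    · rw [e.deriv_eq, L.isPath_old.deriv_fst]
      exact dσ t ht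
  have dj : ∀ t ∈ Ioo (L.start j) (L.finish j), (deriv γ t).1 = 0 ∧ 0 ≤ τ * (deriv γ t).2 := by
    intro t ht
    have e : γ =ᶠ[nhds t] L.old := by
      filter_upwards [Icc_mem_nhds ht.1 ht.2] with u hu using fj u hu
    refine ⟨?_, ?_⟩
    · rw [hγ.deriv_fst]
      exact deriv_eq_zero_of_eqOn jx t ht
    · rw [e.deriv_eq, L.isPath_old.deriv_snd]
      exact dτ t ht
  have height : ∀ a b, a ≠ b →
      E.crossingSign (cr a b) (cr b a) = heightSign level a b *
        (SignType.sign (planeDet (deriv γ (cr a b)) (deriv γ (cr b a))) : ℤ) := by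
    intro a b hab
    rw [hγ.crossingSign_eq (hT.1 a b hab) (hT.1 b a hab.symm) (hT.curve_eq hab)]
    have := hlevel a b hab _ (hT.mem_arc hab) _ (hT.mem_arc hab.symm) (hT.curve_eq hab)
    unfold heightSign
    by_cases h : level b < level a <;> simp [h, this]
  have det_ne : ∀ a b, a ≠ b → planeDet (deriv γ (cr a b)) (deriv γ (cr b a)) ≠ 0 :=
    fun a b hab => hγ.planeDet_ne_zero (hT.1 a b hab) (hT.1 b a hab.symm) (hT.curve_eq hab)
      (L.ne_of_index_ne hab (hT.mem_arc hab) (hT.mem_arc hab.symm))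
  have kne : cr k j ≠ cr k i := hT.cr_ne hjk.symm hij.symm hki.symm
  refine ⟨?_, ?_, ?_, ?_, ?_⟩
  · have hdet : planeDet (deriv γ (cr i j)) (deriv γ (cr j i)) =
        (deriv γ (cr i j)).1 * (deriv γ (cr j i)).2 := by
      rw [planeDet, (di _ (hT.1 i j hij)).1]; ring
    have hne := det_ne i j hij
    rw [hdet] at hne
    rw [height i j hij, hdet, sign_mul_eq hσ hτ (di _ (hT.1 i j hij)).2
      (dj _ (hT.1 j i hij.symm)).2 hne]
  · have hdet : planeDet (deriv γ (cr i k)) (deriv γ (cr k i)) =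
        (deriv γ (cr i k)).1 * (deriv γ (cr k i)).2 := by
      rw [planeDet, (di _ (hT.1 i k hki.symm)).1]; ring
    have hne := det_ne i k hki.symm
    rw [hdet] at hne
    rw [height i k hki.symm, hdet, sign_mul_eq hσ (Or.inr rfl) (di _ (hT.1 i k hki.symm)).2
      (by push_cast; linarith) hne]
    ring
  · have hdet : planeDet (deriv γ (cr j k)) (deriv γ (cr k j)) =
        (deriv γ (cr j k)).2 * -(deriv γ (cr k j)).1 := by
      rw [planeDet, (dj _ (hT.1 j k hjk)).1]; ring
    have hne := det_ne j k hjk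
    rw [hdet] at hne
    rw [height j k hjk, hdet, sign_mul_eq hτ (Or.inr rfl) (dj _ (hT.1 j k hjk)).2
      (by push_cast; linarith) hne]
    ring
  -- On the horizontal axis the crossing with `j` is at the origin. The crossing with `k` is to the
  -- right of it exactly when `k` has already met the vertical axis.
  · rw [oσ _ mij _ mik, ← fi _ mij, ← fi _ mik, gij, gik, jx _ mji]
    have hn : 0 < -(γ (cr k i)).1 ↔ cr k i < cr k j := x_neg _ mki
    have hz : -(γ (cr k i)).1 ≠ 0 := fun h => kne.symm ((x_zero _ mki).mp h)
    rcases hσ with rfl | rfl <;> rcases lt_or_gt_of_ne kne with h | h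
    · have : 0 < (γ (cr k i)).1 := by
        by_contra hc
        exact h.not_gt (hn.mp (lt_of_le_of_ne (by linarith) hz.symm))
      simpa [h] using this
    · have := hn.mpr h
      simp [not_lt_of_gt h]; linarith
    · have : 0 < (γ (cr k i)).1 := by
        by_contra hc
        exact h.not_gt (hn.mp (lt_of_le_of_ne (by linarith) hz.symm))
      simp [h]; linarith
    · have := hn.mpr h
      simp [not_lt_of_gt h]; linarith
  · rw [oτ _ mji _ mjk, ← fj _ mji, ← fj _ mjk, ← gij, gjk, iy _ mij]
    have hn : 0 < (γ (cr k j)).2 ↔ cr k j < cr k i := y_pos _ mkj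
    have hz : (γ (cr k j)).2 ≠ 0 := fun h => kne ((y_zero _ mkj).mp h)
    rw [← hn]
    rcases hτ with rfl | rfl
    · simp
    · simp only [Int.reduceNeg, Int.cast_neg, Int.cast_one]
      norm_num
      exact ⟨fun h => h.le, fun h => lt_of_le_of_ne h hz⟩

end IsTriangle
end LocalChange

/-! ### The signed sum over the edges of a triangle -/

open Classical in
theorem triangleSign_eq (cr : Fin 3 → Fin 3 → ℝ) :
    triangleSign cr = (if cr 0 2 < cr 0 1 then -1 else 1) * (if cr 1 0 < cr 1 2 then -1 else 1) *
      (if cr 2 1 < cr 2 0 then -1 else 1) := by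
  unfold triangleSign
  rw [Set.ncard_eq_toFinset_card', Set.toFinset_ofPred, Finset.card_filter, Fin.sum_univ_three,
    show (0 : Fin 3) - 1 = 2 from rfl, show (0 : Fin 3) + 1 = 1 from rfl,
    show (1 : Fin 3) - 1 = 0 from rfl, show (1 : Fin 3) + 1 = 2 from rfl,
    show (2 : Fin 3) - 1 = 1 from rfl, show (2 : Fin 3) + 1 = 0 from rfl]
  split_ifs <;> norm_num

theorem heightSign_swap {level : Fin 3 → ℕ} (h : Function.Injective level) {a b : Fin 3}
    (hab : a ≠ b) : heightSign level b a = -heightSign level a b := by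
  have := h.ne hab
  unfold heightSign
  split_ifs <;> first | rfl | omega

/-- For a triangle formed by two axes and a third strand, the sum over its edges of the products of the
signs of the two crossings on the edge, each with the sign that tells in which order they are met. -/
theorem sum_edges_eq_neg_triangleSign {cr : Fin 3 → Fin 3 → ℝ} {e : Fin 3 → Fin 3 → ℤ}
    {level : Fin 3 → ℕ} (hlevel : Function.Injective level)
    (hcr : ∀ a b c : Fin 3, a ≠ b → b ≠ c → c ≠ a → cr a b ≠ cr a c)
    (he : ∀ a b : Fin 3, a ≠ b → e b a = e a b)
    {i j k : Fin 3} (hij : i ≠ j) (hjk : j ≠ k) (hki : k ≠ i)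
    {σ τ : ℤ} (hσ : σ = 1 ∨ σ = -1) (hτ : τ = 1 ∨ τ = -1)
    (eij : e i j = heightSign level i j * (σ * τ)) (eik : e i k = heightSign level i k * -σ)
    (ejk : e j k = heightSign level j k * -τ)
    (oi : cr i j < cr i k ↔ (σ = 1 ↔ cr k j < cr k i))
    (oj : cr j i < cr j k ↔ (τ = 1 ↔ cr k j < cr k i)) :
    e 0 1 * e 0 2 * (if cr 0 1 < cr 0 2 then 1 else -1) +
      e 0 1 * e 1 2 * (if cr 1 2 < cr 1 0 then 1 else -1) +
      e 0 2 * e 1 2 * (if cr 2 0 < cr 2 1 then 1 else -1) = -triangleSign cr := by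
  have flip : ∀ {x y : ℝ}, x ≠ y → (y < x ↔ ¬ x < y) := fun h =>
    ⟨fun a => a.not_gt, fun a => lt_of_le_of_ne (not_lt.mp a) h.symm⟩
  have f0 := flip (hcr 0 1 2 (by decide) (by decide) (by decide))
  have f1 := flip (hcr 1 2 0 (by decide) (by decide) (by decide))
  have f2 := flip (hcr 2 0 1 (by decide) (by decide) (by decide))
  have e10 := he 0 1 (by decide)
  have e20 := he 0 2 (by decide)
  have e21 := he 1 2 (by decide)
  have h10 := heightSign_swap hlevel (show (0 : Fin 3) ≠ 1 by decide)
  have h20 := heightSign_swap hlevel (show (0 : Fin 3) ≠ 2 by decide)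
  have h21 := heightSign_swap hlevel (show (1 : Fin 3) ≠ 2 by decide)
  have hsum := heightSign_sum hlevel
  have perms : ∀ i j k : Fin 3, i ≠ j → j ≠ k → k ≠ i →
      (i = 0 ∧ j = 1 ∧ k = 2) ∨ (i = 1 ∧ j = 2 ∧ k = 0) ∨ (i = 2 ∧ j = 0 ∧ k = 1) ∨
      (i = 0 ∧ j = 2 ∧ k = 1) ∨ (i = 1 ∧ j = 0 ∧ k = 2) ∨ (i = 2 ∧ j = 1 ∧ k = 0) := by
    omega
  rw [triangleSign_eq]
  simp only [h10, h20, h21] at hsum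
  simp only [f0, f1, f2]
  clear hcr he flip hlevel
  -- Let `κ` be `1` if `k` meets `j` before `i`, and `-1` otherwise. The triangle sign is `σ * τ *
  -- κ` for a cyclic order `i, j, k` and its negative otherwise. Each edge term is minus the
  -- triangle sign times the two height signs on that edge, and `hsum` adds these up. The case split
  -- verifies this.
  rcases perms i j k hij hjk hki with
    ⟨rfl, rfl, rfl⟩ | ⟨rfl, rfl, rfl⟩ | ⟨rfl, rfl, rfl⟩ |
    ⟨rfl, rfl, rfl⟩ | ⟨rfl, rfl, rfl⟩ | ⟨rfl, rfl, rfl⟩ <;>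
  simp only [e10, e20, e21, h10, h20, h21, f0, f1, f2] at eij eik ejk oi oj <;>
  rw [eij, eik, ejk] <;>
  clear perms hij hjk hki e10 e20 e21 h10 h20 h21 f0 f1 f2 eij eik ejk <;>
  rcases hσ with rfl | rfl <;> rcases hτ with rfl | rfl <;>
  by_cases A : cr 0 1 < cr 0 2 <;> by_cases B : cr 1 2 < cr 1 0 <;>
  by_cases C : cr 2 0 < cr 2 1 <;> simp [A, B, C] at oi oj ⊢ <;> linarith

namespace LocalChange

variable {D D' : KnotDiagram}

/-- The crossing signs and the links with outside crossings are the same before and after. Only the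
three interleavings within the triangle change, and each of them toggles. -/
theorem IsRIII.change {L : LocalChange 3 D D'} {ε : ℤ} (h : L.IsRIII ε) :
    D'.cowrithe = D.cowrithe - ε ∧ D'.numCrossings = D.numCrossings ∧ D'.writhe = D.writhe := by
  classical
  obtain ⟨⟨level, hinj, hlevel⟩, i, j, k, hij, hjk, hki, hi, fi, hj, fj, xs, ys, xf, yf, cr, cr',
    hT, hT', hrev, hε⟩ := h
  have hO := L.isPath_old
  have hN := L.isPath_new
  have iy : ∀ t ∈ L.arc i, (L.old t).2 = 0 := fun t ht => by
    have : L.old t ∈ Icc (-1 : ℝ) 1 ×ˢ ({0} : Set ℝ) := hi ▸ mem_image_of_mem _ ht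
    exact this.2
  have jx : ∀ t ∈ L.arc j, (L.old t).1 = 0 := fun t ht => by
    have : L.old t ∈ ({0} : Set ℝ) ×ˢ Icc (-1 : ℝ) 1 := hj ▸ mem_image_of_mem _ ht
    exact this.1
  obtain ⟨σ, hσ, oσ, dσ⟩ := exists_sign_of_injOn hO.differentiable_fst (L.start_lt_finish i)
    (fun s hs t ht e => hT.injOn i hs ht ((hO.curve_eq_iff hs ht).mpr
      (Prod.ext e ((iy s hs).trans (iy t ht).symm))))
  obtain ⟨τ, hτ, oτ, dτ⟩ := exists_sign_of_injOn hO.differentiable_snd (L.start_lt_finish j)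
    (fun s hs t ht e => hT.injOn j hs ht ((hO.curve_eq_iff hs ht).mpr
      (Prod.ext ((jx s hs).trans (jx t ht).symm) e)))
  obtain ⟨eij, eik, ejk, -, -⟩ := hT.signs_and_order hO
    (fun a b hab s hs t ht => (hlevel a b hab s hs t ht).1) hij hjk hki hi (fun _ _ => rfl) hj
    (fun _ _ => rfl) xs ys xf yf hσ hτ oσ dσ oτ dτ
  -- The axes do not move and strand `k` keeps its ends, so `signs_and_order` applies to `D'` with
  -- the same `σ` and `τ`, and the signs coincide.
  have ns := L.new_eq_old (L.start_mem k) (L.isOuter_start k)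
  have nf := L.new_eq_old (L.finish_mem k) (L.isOuter_finish k)
  rw [← ns] at xs ys
  rw [← nf] at xf yf
  obtain ⟨eij', eik', ejk', oi, oj⟩ := hT'.signs_and_order hN
    (fun a b hab s hs t ht => (hlevel a b hab s hs t ht).2) hij hjk hki hi fi hj fj
    xs ys xf yf hσ hτ oσ dσ oτ dτ
  have key := sum_edges_eq_neg_triangleSign (e := fun a b => D'.crossingSign (cr' a b) (cr' b a))
    hinj (fun a b c => hT'.cr_ne) (fun a b => hT'.crossingSign_comm) hij hjk hki hσ hτ
    eij' eik' ejk' oi oj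
  have sign_eq : ∀ a b, a ≠ b →
      D.crossingSign (cr a b) (cr b a) = D'.crossingSign (cr' a b) (cr' b a) := by
    have aux : ∀ a b, a ≠ b →
        D.crossingSign (cr a b) (cr b a) = D'.crossingSign (cr' a b) (cr' b a) →
        D.crossingSign (cr b a) (cr a b) = D'.crossingSign (cr' b a) (cr' a b) :=
      fun a b hab e => by rw [hT.crossingSign_comm hab, hT'.crossingSign_comm hab, e]
    have sij := eij.trans eij'.symm
    have sik := eik.trans eik'.symm
    have sjk := ejk.trans ejk'.symm
    have cover : ∀ i j k a b : Fin 3, i ≠ j → j ≠ k → k ≠ i → a ≠ b →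
        (a = i ∧ b = j) ∨ (a = j ∧ b = i) ∨ (a = i ∧ b = k) ∨ (a = k ∧ b = i) ∨
        (a = j ∧ b = k) ∨ (a = k ∧ b = j) := by decide
    intro a b hab
    rcases cover i j k a b hij hjk hki hab with ⟨rfl, rfl⟩ | ⟨rfl, rfl⟩ | ⟨rfl, rfl⟩ | ⟨rfl, rfl⟩ |
      ⟨rfl, rfl⟩ | ⟨rfl, rfl⟩
    · exact sij
    · exact aux _ _ hij sij
    · exact sik
    · exact aux _ _ hki.symm sik
    · exact sjk
    · exact aux _ _ hjk sjk
  obtain ⟨n1, w1, x1⟩ := hT.counts hO L.mem_common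
  obtain ⟨n2, w2, x2⟩ := hT'.counts hN L.mem_common'
  have link : ∀ a b : Fin 3, a ≠ b →
      linkSum L.common (fun c => D'.crossingSign c.1 c.2) (cr' a b, cr' b a) =
      linkSum L.common (fun c => D.crossingSign c.1 c.2) (cr a b, cr b a) := fun a b hab =>
    linkSum_congr L.common_sign (L.interleaved_iff_of_mem (hT'.1 a b hab) (hT.1 a b hab)
      (hT'.1 b a hab.symm) (hT.1 b a hab.symm))
  -- As the order is reversed, exactly one of the two indicators is `1`, so the sign in `key` is the
  -- new indicator minus the old one.
  have reverse : ∀ a b c : Fin 3, a ≠ b → b ≠ c → c ≠ a →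
      (if cr' a b < cr' a c then (1 : ℤ) else -1) =
      (if cr' a b < cr' a c then 1 else 0) - (if cr a b < cr a c then 1 else 0) := by
    intro a b c hab hbc hca
    have h1 := hrev a b c hab hbc hca
    rcases lt_or_gt_of_ne (hT'.cr_ne hab hbc hca) with h | h
    · simp [h1, h, not_lt_of_gt h]
    · simp [h1, h, not_lt_of_gt h]
  refine ⟨?_, n2.trans n1.symm, ?_⟩
  · rw [hε, reverse 0 1 2 (by decide) (by decide) (by decide),
      reverse 1 2 0 (by decide) (by decide) (by decide),
      reverse 2 0 1 (by decide) (by decide) (by decide)] at key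
    rw [x2, x1, link 0 1 (by decide), link 0 2 (by decide), link 1 2 (by decide),
      sign_eq 0 1 (by decide), sign_eq 0 2 (by decide), sign_eq 1 2 (by decide),
      interleavedSum_congr L.common_sign]
    linear_combination key
  · rw [w2, w1, sign_eq 0 1 (by decide), sign_eq 0 2 (by decide), sign_eq 1 2 (by decide),
      Finset.sum_congr rfl L.common_sign]

end LocalChange

/-! ### The effect of the moves on the two invariants -/

namespace KnotDiagram

theorem RICreating.change {ε : ℤ} {D D' : KnotDiagram} (h : RICreating ε D D') :
    D'.minusInvariant = D.minusInvariant + (1 - ε) / 2 ∧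
      D'.plusInvariant = D.plusInvariant + (1 + ε) / 2 := by
  obtain ⟨E, E', hE, hE', L, hL⟩ := h
  obtain ⟨h1, h2, h3⟩ := hL.change
  rw [hE'.minusInvariant_eq, ← hE.minusInvariant_eq, hE'.plusInvariant_eq, ← hE.plusInvariant_eq]
  unfold minusInvariant plusInvariant
  rw [h1, h2, h3]
  push_cast
  constructor <;> ring

theorem MatchedRIICreating.change {D D' : KnotDiagram} (h : MatchedRIICreating D D') :
    D'.minusInvariant = D.minusInvariant ∧ D'.plusInvariant = D.plusInvariant := by
  obtain ⟨E, E', hE, hE', L, hL⟩ := h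
  obtain ⟨h1, h2, h3⟩ := hL.change
  rw [hE'.minusInvariant_eq, ← hE.minusInvariant_eq, hE'.plusInvariant_eq, ← hE.plusInvariant_eq]
  unfold minusInvariant plusInvariant
  rw [h1, h2, h3, if_pos trivial]
  push_cast
  constructor <;> ring

theorem MatchedRII.change {D D' : KnotDiagram} (h : MatchedRII D D') :
    D'.minusInvariant = D.minusInvariant ∧ D'.plusInvariant = D.plusInvariant := by
  rcases h with h | h
  · exact h.change
  · exact ⟨h.change.1.symm, h.change.2.symm⟩

theorem UnmatchedRIICreating.change {D D' : KnotDiagram} (h : UnmatchedRIICreating D D') :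
    D'.minusInvariant = D.minusInvariant + 1 ∧ D'.plusInvariant = D.plusInvariant + 1 := by
  obtain ⟨E, E', hE, hE', L, hL⟩ := h
  obtain ⟨h1, h2, h3⟩ := hL.change
  rw [hE'.minusInvariant_eq, ← hE.minusInvariant_eq, hE'.plusInvariant_eq, ← hE.plusInvariant_eq]
  unfold minusInvariant plusInvariant
  rw [h1, h2, h3, if_neg not_false]
  push_cast
  constructor <;> ring

theorem NegativeRIII.change {D D' : KnotDiagram} (h : NegativeRIII D D') :
    D'.minusInvariant = D.minusInvariant + 1 ∧ D'.plusInvariant = D.plusInvariant + 1 := by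
  obtain ⟨E, E', hE, hE', L, hL⟩ := h
  obtain ⟨h1, h2, h3⟩ := hL.change
  rw [hE'.minusInvariant_eq, ← hE.minusInvariant_eq, hE'.plusInvariant_eq, ← hE.plusInvariant_eq]
  unfold minusInvariant plusInvariant
  rw [h1, h2, h3]
  push_cast
  constructor <;> ring

end KnotDiagram

theorem corollary2 (D D' : KnotDiagram) :
    ((KnotDiagram.RICreating 1 D D' → D'.minusInvariant = D.minusInvariant) ∧
      (KnotDiagram.MatchedRII D D' → D'.minusInvariant = D.minusInvariant) ∧
      (KnotDiagram.RICreating (-1) D D' → D'.minusInvariant = D.minusInvariant + 1) ∧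
      (KnotDiagram.UnmatchedRIICreating D D' → D'.minusInvariant = D.minusInvariant + 1) ∧
      (KnotDiagram.NegativeRIII D D' → D'.minusInvariant = D.minusInvariant + 1)) ∧
    ((KnotDiagram.RICreating (-1) D D' → D'.plusInvariant = D.plusInvariant) ∧
      (KnotDiagram.MatchedRII D D' → D'.plusInvariant = D.plusInvariant) ∧
      (KnotDiagram.RICreating 1 D D' → D'.plusInvariant = D.plusInvariant + 1) ∧
      (KnotDiagram.UnmatchedRIICreating D D' → D'.plusInvariant = D.plusInvariant + 1) ∧
      (KnotDiagram.NegativeRIII D D' → D'.plusInvariant = D.plusInvariant + 1)) := by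
  refine ⟨⟨fun h => ?_, fun h => h.change.1, fun h => ?_, fun h => h.change.1,
    fun h => h.change.1⟩, fun h => ?_, fun h => h.change.2, fun h => ?_, fun h => h.change.2,
    fun h => h.change.2⟩
  · rw [h.change.1]; norm_num
  · rw [h.change.1]; norm_num
  · rw [h.change.2]; norm_num
  · rw [h.change.2]; norm_num
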